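/- Let $\ell,d\in\mathbb{N}$, let $U\subset\mathbb{R}^\ell$ be compact with positive Lebesgue measure, and let $\mathcal S=\{1,\dots,d\}$. For each $u\in U$ let $q^u=(q^u_{ij})_{i,j\in\mathcal S}$ be a rate matrix, i.e. $q^u_{ij}\ge 0$ for $j\neq i$ and $q^u_{ii}=-\sum_{j\ne i}q^u_{ij}$, and let $f:[0,\infty)\times\mathcal S\times U\to\mathbb{R}$ be a reward function, where $t$ in $f(t,i,u)$ is the time elapsed between the moment of evaluation and the moment of the reward. Assume: 1. $\int_0^\infty \sup_{i\in\mathcal S,\,u\in U}|f(s,i,u)|\,ds<\infty$; 2. $t\mapsto f(t,i,u)$ is continuous on $[0,\infty)$ for all $i\in\mathcal S$, $u\in U$; 3. $u\mapsto f(t,i,u)$ and $u\mapsto q^u_i$ (the $i$-th row of $q^u$) are Lipschitz on $U$, uniformly in $(t,i)\in[0,\infty)\times\mathcal S$; 4. (uniform cone condition) there are $\vartheta>0$ and $\iota\in(0,\pi/2]$ such that for every $u\in U$ there is a unit vector $e\in\mathbb{R}^\ell$ with $\{v\in\mathbb{R}^\ell:\ |v-u|<\vartheta,\ (v-u)\cdot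 e\ge |v-u|\cos\iota\}\subseteq U$. A relaxed control is a map $\pi:\mathcal S\to\mathcal P(U)$ into the Borel probability measures on $U$; let $\Pi$ be the set of all of them. Write $f^{\mu}(t,i)=\int_U f(t,i,u)\,\mu(du)$ for $\mu\in\mathcal P(U)$. Under $\pi\in\Pi$, the state process $X^\pi$ is the continuous-time Markov chain on $\mathcal S$ whose rate matrix has entries $\int_U q^u_{ij}\,(\pi(i))(du)$, and the value of $\pi$ is $$\widetilde J^{\pi}(i)=\mathbb{E}_i\Big[\int_0^\infty f^{\pi(X^\pi_s)}(s,X^\pi_s)\,ds\Big],\qquad i\in\mathcal S.$$ For $\pi,\pi'\in\Pi$ and $\varepsilon>0$ let $\pi'\otimes_\varepsilon\pi$ denote the control that uses $\pi'$ on $[0,\varepsilon)$ and $\pi$ on $[\varepsilon,\infty)$, and let $\widetilde J^{\pi'\otimes_\varepsilon\pi}(i)$ be the corresponding value. Then there exists a relaxed equilibrium, i.e. a $\pi\in\Pi$ such that $$\limsup_{\varepsilon\downarrow0}\frac{\widetilde J^{\pi'\otimes_\varepsilon\pi}(i)-\widetilde J^{\pi}(i)}{\varepsilon}\le 0\qquad\text{for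 all }\pi'\in\Pi\text{ and } i\in\mathcal S.$$ -/

import Mathlib

open MeasureTheory ProbabilityTheory Filter Topology Set
open scoped ENNReal

noncomputable section

namespace RelaxedMDP

/-- `A` is a rate matrix (generator): nonnegative off-diagonal entries, and each diagonal entry is
minus the sum of the other entries of its row. -/
def IsRateMatrix {d : ℕ} (A : Matrix (Fin d) (Fin d) ℝ) : Prop :=
  (∀ i j, j ≠ i → 0 ≤ A i j) ∧ ∀ i, A i i = -∑ j ∈ Finset.univ.erase i, A i j

/-- The (solid, one-sided) cone with vertex `u`, unit axis direction `e` and angle `ι`: the points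
`v` such that `v - u` makes an angle at most `ι` with `e`. For `ι < π / 2` and `e` the last
coordinate vector, these are the `v` such that `w = v - u` satisfies
`w₁² + ⋯ + w_{ℓ-1}² ≤ tan² ι * w_ℓ²` and `0 ≤ w_ℓ`. -/
def solidCone {ℓ : ℕ} (u e : EuclideanSpace ℝ (Fin ℓ)) (ι : ℝ) : Set (EuclideanSpace ℝ (Fin ℓ)) :=
  {v | ‖v - u‖ * Real.cos ι ≤ inner ℝ (v - u) e}

/-- The uniform cone condition. In dimension one the truncated cones are the half-open intervals
`[u, u + θ)` and `(u - θ, u]`. -/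
def UniformConeCondition {ℓ : ℕ} (U : Set (EuclideanSpace ℝ (Fin ℓ))) : Prop :=
  ∃ θ : ℝ, 0 < θ ∧ ∃ ι : ℝ, 0 < ι ∧ ι ≤ Real.pi / 2 ∧
    ∀ u ∈ U, ∃ e : EuclideanSpace ℝ (Fin ℓ), ‖e‖ = 1 ∧ solidCone u e ι ∩ Metric.ball u θ ⊆ U

section MarkovChain

variable {d : ℕ}

/-- The law of the next state when a chain with rate matrix `Q` leaves the state `i`: the state
`j ≠ i` has probability `Q i j / ∑ k ≠ i, Q i k = -Q i j / Q i i`. An absorbing state is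
never left, and there the value is irrelevant (point mass at `i`). -/
def jumpPMF (Q : Matrix (Fin d) (Fin d) ℝ) (i : Fin d) : PMF (Fin d) :=
  if h : (∑' j, if j = i then 0 else ENNReal.ofReal (Q i j)) = 0 then PMF.pure i
  else PMF.normalize (fun j => if j = i then 0 else ENNReal.ofReal (Q i j)) h (by
    rw [tsum_fintype]
    refine (ENNReal.sum_lt_top.2 fun j _ => ?_).ne
    split_ifs <;> simp)

/-- The noise that drives a chain: at each step a standard exponential variable and a random map
that sends each state to a candidate for the next state. -/
abbrev Noise (d : ℕ) : Type := ℕ → ℝ × (Fin d → Fin d)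

instance isProbabilityMeasure_expMeasure_one : IsProbabilityMeasure (expMeasure 1) :=
  isProbabilityMeasure_expMeasure one_pos

/-- The law of the noise: steps are independent; within a step, the exponential variable and the
candidates for the next state are independent, and the candidate at `i` has law `jumpPMF Q i`. -/
def noiseLaw (Q : Matrix (Fin d) (Fin d) ℝ) : Measure (Noise d) :=
  Measure.infinitePi fun _ : ℕ =>
    (expMeasure 1).prod (Measure.pi fun i : Fin d => (jumpPMF Q i).toMeasure)

/-- The successive states visited by the chain started at `i`. -/
def visited (i : Fin d) (ω : Noise d) : ℕ → Fin d
  | 0 => i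
  | n + 1 => (ω n).2 (visited i ω n)

/-- The `n`-th holding time: exponential with parameter `-Q j j`, where `j` is the `n`-th visited
state; infinite if this parameter is `0`. -/
def holdingTime (Q : Matrix (Fin d) (Fin d) ℝ) (i : Fin d) (ω : Noise d) (n : ℕ) : ℝ≥0∞ :=
  ENNReal.ofReal (ω n).1 / ENNReal.ofReal (-Q (visited i ω n) (visited i ω n))

/-- The time of the `n`-th jump (the `0`-th being time `0`). -/
def jumpTime (Q : Matrix (Fin d) (Fin d) ℝ) (i : Fin d) (ω : Noise d) (n : ℕ) : ℝ≥0∞ :=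
  ∑ k ∈ Finset.range n, holdingTime Q i ω k

/-- The continuous-time Markov chain with rate matrix `Q` started at `i`, at time `t ≥ 0`: it sits
in the `n`-th visited state from the `n`-th jump time until just before the next one. -/
def chain (Q : Matrix (Fin d) (Fin d) ℝ) (i : Fin d) (t : ℝ) (ω : Noise d) : Fin d :=
  visited i ω (sInf {n : ℕ | ENNReal.ofReal t < jumpTime Q i ω (n + 1)})

end MarkovChain

section Control

variable {d : ℕ} {U : Type*} [MeasurableSpace U]

/-- A relaxed feedback control. -/
abbrev RelaxedControl (d : ℕ) (U : Type*) [MeasurableSpace U] : Type _ :=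
  Fin d → ProbabilityMeasure U

/-- The relaxed rate matrix `Q^μ` of a probability measure `μ` on the actions. -/
def relaxedRate (q : U → Matrix (Fin d) (Fin d) ℝ) (μ : ProbabilityMeasure U) :
    Matrix (Fin d) (Fin d) ℝ :=
  Matrix.of fun i j => ∫ u, q u i j ∂(μ : Measure U)

/-- The rate matrix under the relaxed control `π`: row `i` is the row `i` of `Q^{π(i)}`. -/
def controlledRate (q : U → Matrix (Fin d) (Fin d) ℝ) (π : RelaxedControl d U) :
    Matrix (Fin d) (Fin d) ℝ :=
  Matrix.of fun i => relaxedRate q (π i) i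

/-- The averaged reward `f^μ(t, i)`. -/
def relaxedReward (f : ℝ → Fin d → U → ℝ) (μ : ProbabilityMeasure U) (t : ℝ) (i : Fin d) : ℝ :=
  ∫ u, f t i u ∂(μ : Measure U)

/-- The value `E_i[∫_0^∞ f^{π(X_s)}(s, X_s) ds]` of the relaxed control `π`, where `X` is the chain
controlled by `π`. -/
def value (q : U → Matrix (Fin d) (Fin d) ℝ) (f : ℝ → Fin d → U → ℝ)
    (π : RelaxedControl d U) (i : Fin d) : ℝ :=
  ∫ ω, (∫ s in Ioi (0 : ℝ),
      relaxedReward f (π (chain (controlledRate q π) i s ω)) s (chain (controlledRate q π) i s ω))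
    ∂(noiseLaw (controlledRate q π))

/-- The state at time `s` when the control is `π'` on `[0, ε)` and `π` on `[ε, ∞)`: from time `ε`
on, a chain controlled by `π` and driven by fresh independent noise is started at the state
that the chain controlled by `π'` has reached at time `ε`. -/
def concatChain (q : U → Matrix (Fin d) (Fin d) ℝ) (π' π : RelaxedControl d U) (ε : ℝ)
    (i : Fin d) (s : ℝ) (ω : Noise d × Noise d) : Fin d :=
  if s < ε then chain (controlledRate q π') i s ω.1
  else chain (controlledRate q π) (chain (controlledRate q π') i ε ω.1) (s - ε) ω.2

/-- The value of the concatenation of `π'` and `π` at time `ε`. -/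
def concatValue (q : U → Matrix (Fin d) (Fin d) ℝ) (f : ℝ → Fin d → U → ℝ)
    (π' π : RelaxedControl d U) (ε : ℝ) (i : Fin d) : ℝ :=
  ∫ ω, (∫ s in Ioi (0 : ℝ),
      relaxedReward f ((if s < ε then π' else π) (concatChain q π' π ε i s ω)) s
        (concatChain q π' π ε i s ω))
    ∂((noiseLaw (controlledRate q π')).prod (noiseLaw (controlledRate q π)))

/-- `π` is a relaxed equilibrium for the unregularized continuous-time problem. The upper limit is
taken in the extended reals. -/
def IsRelaxedEquilibrium (q : U → Matrix (Fin d) (Fin d) ℝ) (f : ℝ → Fin d → U → ℝ)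
    (π : RelaxedControl d U) : Prop :=
  ∀ (π' : RelaxedControl d U) (i : Fin d),
    limsup (fun ε : ℝ => (((concatValue q f π' π ε i - value q f π i) / ε : ℝ) : EReal)) (𝓝[>] 0)
      ≤ 0

end Control

end RelaxedMDP

end

/-! Write `V` for the value of a control `π` and `H_i(μ) = f^μ(0,i) + ∑ k, q^μ_{ik} V(k)`. Using
`π'` on `[0, ε)` changes the value in two ways: through the rewards collected before `ε`, and
through the law of the state at `ε`. The reward accumulated after `ε` from a given state is the same
for `π' ⊗_ε π` and for `π`, even though rewards are dated from time `0`, and it tends to `V` as `ε ↓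
0`. Hence the difference quotient converges to `H_i(π'(i)) - H_i(π(i))`
(`IsRegular.tendsto_concatValue_sub_div`), and it suffices to find `π` such that each `π(i)`
maximizes the Hamiltonian built from the value of `π` itself.

This is a fixed point problem for a set-valued map, made single-valued by approximation. At level
`n` only the first `n + 1` points of a dense sequence in `U` compete, and
`exists_continuous_almost_maximizer` gives almost maximizing distributions depending continuously on
`V`. The map from `V` to the value of the resulting control is continuous and bounded on `ℝ^d`, so
Brouwer's theorem applies. Controls form a compact space for weak convergence, on which value and
Hamiltonian are continuous; a cluster point of the approximate solutions is an exact one.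

Two inputs are proved on the way. Brouwer's theorem is derived from Scarf's lemma, a parity
argument. The chain built from exponential clocks has the matrix exponential as its transition law
(`IsRateMatrix.measureReal_chain_eq`), because both solve the same first-step equation, which is a
contraction. -/

namespace Scarf

/-! ### Scarf's lemma on dominant sets in several linear orders -/

section Scarf

variable {X I α : Type*} [DecidableEq X] [Fintype I] [DecidableEq I] [LinearOrder α]

/-- A finite set is dominant for a family of linear orders (given by keys `h i`) if no point is
strictly above all the minima of the set. -/
def Dominant (h : I → X → α) (R : Finset X) : Prop := ∀ y, ∃ i, ∀ x ∈ R, h i y ≤ h i x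

omit [DecidableEq X] [Fintype I] [DecidableEq I] in
lemma Dominant.mono {h : I → X → α} {R E : Finset X} (hR : Dominant h R) (hE : E ⊆ R) :
    Dominant h E := fun y => (hR y).imp fun _ hi x hx => hi x (hE hx)

/-- `y` is above the points `m l` in all orders `l ≠ i`. -/
def Above (h : I → X → α) (m : I → X) (i : I) (y : X) : Prop := ∀ l, l ≠ i → h l (m l) < h l y

/-- `z` is the largest point, in the order `i`, of those that are above `m` in the other orders. -/
def IsTop (h : I → X → α) (m : I → X) (i : I) (z : X) : Prop :=
  Above h m i z ∧ ∀ y, Above h m i y → h i y ≤ h i z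

/-- `m` selects the minima of `E`, and `i`, `j` are the only two orders with the same minimum. -/
structure IsTwin (h : I → X → α) (E : Finset X) (m : I → X) (i j : I) : Prop where
  mem : ∀ l, m l ∈ E
  le : ∀ l, ∀ x ∈ E, h l (m l) ≤ h l x
  surj : ∀ x ∈ E, ∃ l, m l = x
  ne : i ≠ j
  eq : m i = m j
  unique : ∀ k l, k ≠ l → m k = m l → (k = i ∧ l = j) ∨ (k = j ∧ l = i)

-- Dominance tested at a point of `E` makes that point the minimum of `E` in some order, so `m : I →
-- E` is onto. As `I` has one element more than `E`, exactly one pair of orders shares its minimum.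
omit [DecidableEq X] in
lemma exists_isTwin {h : I → X → α} (hinj : ∀ i, Function.Injective (h i)) {E : Finset X}
    (hE : E.Nonempty) (hcard : E.card + 1 = Fintype.card I) (hdom : Dominant h E) :
    ∃ m i j, IsTwin h E m i j := by
  have hm : ∀ l, ∃ z ∈ E, ∀ x ∈ E, h l z ≤ h l x := fun l => Finset.exists_min_image E (h l) hE
  choose m hmE hmin using hm
  have hsurj : ∀ x ∈ E, ∃ l, m l = x := by
    intro x hx
    obtain ⟨l, hl⟩ := hdom x
    exact ⟨l, hinj l (le_antisymm (hmin l x hx) (hl _ (hmE l)))⟩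
  obtain ⟨i, -, j, -, hij, hm⟩ := Finset.exists_ne_map_eq_of_card_lt_of_maps_to
    (s := Finset.univ) (t := E) (f := m) (by rw [Finset.card_univ]; omega) (fun l _ => hmE l)
  have key : ∀ i j, i ≠ j → m i = m j → ∀ k l, k ≠ i → l ≠ i → m k = m l → k = l := by
    intro i j hij hm k l hk hl hkl
    have := Finset.injOn_of_surjOn_of_card_le (s := Finset.univ.erase i) (t := E) m
      (fun l _ => hmE l) (by
        intro x hx
        obtain ⟨l, rfl⟩ := hsurj x hx
        by_cases hl : l = i
        · exact ⟨j, by simp [hij.symm], by rw [hl, hm]⟩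
        · exact ⟨l, by simp [hl], rfl⟩)
      (by rw [Finset.card_erase_of_mem (Finset.mem_univ _), Finset.card_univ]; omega)
    exact this (by simp [hk]) (by simp [hl]) hkl
  refine ⟨m, i, j, hmE, hmin, hsurj, hij, hm, fun k l hkl hmkl => ?_⟩
  have h1 := key i j hij hm k l
  have h2 := key j i hij.symm hm.symm k l
  by_cases k = i <;> by_cases l = i <;> by_cases k = j <;> by_cases l = j <;> simp_all

namespace IsTwin

variable {h : I → X → α} {E : Finset X} {m : I → X} {i j : I}

omit [Fintype I] [DecidableEq X] [DecidableEq I] in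
lemma symm (H : IsTwin h E m i j) : IsTwin h E m j i :=
  ⟨H.mem, H.le, H.surj, H.ne.symm, H.eq.symm, fun k l hkl hm => (H.unique k l hkl hm).symm⟩

omit [Fintype I] [DecidableEq X] [DecidableEq I] in
lemma notMem_of_above (H : IsTwin h E m i j) {z : X} (hz : Above h m i z) : z ∉ E := by
  intro hzE
  obtain ⟨k, rfl⟩ := H.surj z hzE
  by_cases hk : k = i
  · subst hk
    have := hz j H.ne.symm
    rw [H.eq] at this
    exact lt_irrefl _ this
  · exact lt_irrefl _ (hz k hk)

-- A point not above `m` is stopped by some order `l ≠ i`, where `m l` stays minimal after adding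
-- `z`; a point above `m` is at most `z` in order `i`. There `z` lies below `E`, since only `i` can
-- witness dominance of `E` at `z`.
omit [Fintype I] [DecidableEq I] in
lemma dominant_of_isTop (H : IsTwin h E m i j) (hdom : Dominant h E) {z : X}
    (hz : IsTop h m i z) : Dominant h (insert z E) := by
  intro y
  by_cases hy : Above h m i y
  · refine ⟨i, fun x hx => ?_⟩
    rcases Finset.mem_insert.1 hx with rfl | hx
    · exact hz.2 y hy
    · refine (hz.2 y hy).trans ?_
      obtain ⟨l, hl⟩ := hdom z
      by_cases hli : l = i
      · exact hli ▸ hl x hx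
      · exact absurd (hl _ (H.mem l)) (not_le.2 (hz.1 l hli))
  · simp only [Above, not_forall, not_lt] at hy
    obtain ⟨l, hl, hyl⟩ := hy
    refine ⟨l, fun x hx => ?_⟩
    rcases Finset.mem_insert.1 hx with rfl | hx
    · exact hyl.trans (hz.1 l hl).le
    · exact hyl.trans (H.le l x hx)

-- Every `x ∈ E` must remain the minimum of the larger set in some order, which leaves only `i` or
-- `j`, and not both, for `z` to be minimal. In that order `z` bounds all points above `m`, as no
-- other order can stop them.
omit [Fintype I] [DecidableEq I] in
lemma isTop_of_dominant (H : IsTwin h E m i j) (hinj : ∀ i, Function.Injective (h i)) {z : X}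
    (hzE : z ∉ E) (hdom : Dominant h (insert z E)) : IsTop h m i z ∨ IsTop h m j z := by
  have hmin : ∀ x ∈ E, ∃ l, m l = x ∧ h l x < h l z := by
    intro x hx
    obtain ⟨l, hl⟩ := hdom x
    refine ⟨l, hinj l (le_antisymm (H.le l x hx) (hl _ (Finset.mem_insert_of_mem (H.mem l)))), ?_⟩
    exact lt_of_le_of_ne (hl z (Finset.mem_insert_self _ _))
      fun hEq => hzE (hinj l hEq ▸ hx)
  have hlow : ∀ k, h k z ≤ h k (m k) → k = i ∨ k = j := by
    intro k hk
    obtain ⟨l, hl, hlt⟩ := hmin (m k) (H.mem k)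
    have hkl : l ≠ k := by rintro rfl; exact absurd hlt (not_lt.2 hk)
    rcases H.unique l k hkl hl with h | h
    · exact Or.inr h.2
    · exact Or.inl h.2
  have hnot : ¬ (h i z ≤ h i (m i) ∧ h j z ≤ h j (m j)) := by
    rintro ⟨hi, hj⟩
    obtain ⟨l, hl, hlt⟩ := hmin (m i) (H.mem i)
    by_cases hli : l = i
    · subst hli; exact absurd hlt (not_lt.2 hi)
    · rcases H.unique l i hli hl with h | h
      · exact hli h.1
      · rw [h.1, H.eq] at hlt
        exact absurd hlt (not_lt.2 hj)
  have main : ∀ i j, (∀ k, h k z ≤ h k (m k) → k = i ∨ k = j) →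
      ¬ (h i z ≤ h i (m i) ∧ h j z ≤ h j (m j)) → h i z ≤ h i (m i) → IsTop h m i z := by
    intro i j hlow hnot hi
    have hab : Above h m i z := by
      intro l hl
      by_contra hcon
      rcases hlow l (not_lt.1 hcon) with h | h
      · exact hl h
      · subst h; exact hnot ⟨hi, not_lt.1 hcon⟩
    refine ⟨hab, fun y hy => ?_⟩
    obtain ⟨l, hl⟩ := hdom y
    by_cases hli : l = i
    · exact hli ▸ hl z (Finset.mem_insert_self _ _)
    · exact absurd (hl _ (Finset.mem_insert_of_mem (H.mem l))) (not_le.2 (hy l hli))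
  obtain ⟨k, hk⟩ := hdom z
  have hk' := hk _ (Finset.mem_insert_of_mem (H.mem k))
  rcases hlow k hk' with rfl | rfl
  · exact Or.inl (main k j hlow hnot hk')
  · exact Or.inr (main k i (fun l hl => (hlow l hl).symm) (fun h => hnot h.symm) hk')

omit [Fintype I] [DecidableEq X] [DecidableEq I] in
lemma not_above_above (H : IsTwin h E m i j) (hdom : Dominant h E) {z : X}
    (hi : Above h m i z) (hj : Above h m j z) : False := by
  obtain ⟨l, hl⟩ := hdom z
  have := hl _ (H.mem l)
  by_cases hli : l = i
  · exact absurd this (not_le.2 (hj l (hli ▸ H.ne)))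
  · exact absurd this (not_le.2 (hi l hli))

end IsTwin

open Classical in
omit [DecidableEq X] [Fintype I] [DecidableEq I] in
lemma card_isTop [Fintype X] {h : I → X → α} (hinj : ∀ i, Function.Injective (h i)) (m : I → X)
    (i : I) : (Finset.univ.filter (IsTop h m i)).card = if ∃ y, Above h m i y then 1 else 0 := by
  split_ifs with hex
  · obtain ⟨y, hy⟩ := hex
    obtain ⟨z, hz, hmax⟩ := Finset.exists_max_image (Finset.univ.filter (Above h m i)) (h i)
      ⟨y, by simpa using hy⟩
    simp only [Finset.mem_filter, Finset.mem_univ, true_and] at hz hmax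
    refine Finset.card_eq_one.2 ⟨z, ?_⟩
    ext w
    simp only [Finset.mem_filter, Finset.mem_univ, true_and, Finset.mem_singleton]
    constructor
    · intro hw
      exact hinj i (le_antisymm (hmax w hw.1) (hw.2 z hz))
    · rintro rfl
      exact ⟨hz, hmax⟩
  · rw [Finset.card_eq_zero, Finset.filter_eq_empty_iff]
    exact fun z _ hz => hex ⟨z, hz.1⟩

-- The analogue of a facet lying in at most two simplices: a set one point short extends at most
-- once for each order of its twin pair.
open Classical in
omit [Fintype I] [DecidableEq I] in
lemma card_extensions [Fintype X] {h : I → X → α} (hinj : ∀ i, Function.Injective (h i))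
    {E : Finset X} {m : I → X} {i j : I} (H : IsTwin h E m i j) (hdom : Dominant h E) :
    (Finset.univ.filter fun z => z ∉ E ∧ Dominant h (insert z E)).card
      = (if ∃ y, Above h m i y then 1 else 0) + if ∃ y, Above h m j y then 1 else 0 := by
  rw [← card_isTop hinj, ← card_isTop hinj, ← Finset.card_union_of_disjoint]
  · congr 1
    ext z
    simp only [Finset.mem_filter, Finset.mem_univ, true_and, Finset.mem_union]
    constructor
    · exact fun hz => H.isTop_of_dominant hinj hz.1 hz.2
    · rintro (hz | hz)
      · exact ⟨H.notMem_of_above hz.1, H.dominant_of_isTop hdom hz⟩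
      · exact ⟨H.symm.notMem_of_above hz.1, H.symm.dominant_of_isTop hdom hz⟩
  · rw [Finset.disjoint_left]
    intro z hz hz'
    simp only [Finset.mem_filter, Finset.mem_univ, true_and] at hz hz'
    exact H.not_above_above hdom hz.1 hz'.1

/-- The points of a rainbow set whose removal leaves exactly the colours other than `i₀`. -/
lemma odd_card_removable {c : X → I} {i₀ : I} {R : Finset X} (hR : R.card = Fintype.card I) :
    Odd (R.filter fun x => (R.erase x).image c = Finset.univ.erase i₀).card ↔
      R.image c = Finset.univ := by
  constructor
  · intro hodd
    by_contra hne
    obtain ⟨x, hx⟩ := Finset.card_pos.1 hodd.pos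
    simp only [Finset.mem_filter] at hx
    obtain ⟨hxR, hx⟩ := hx
    have hinj : Set.InjOn c (R.erase x : Finset X) := by
      rw [← Finset.card_image_iff, hx, Finset.card_erase_of_mem hxR, hR,
        Finset.card_erase_of_mem (Finset.mem_univ _), Finset.card_univ]
    have hcx : c x ≠ i₀ := by
      intro hcx
      apply hne
      rw [← Finset.insert_erase hxR, Finset.image_insert, hx, hcx,
        Finset.insert_erase (Finset.mem_univ _)]
    have : c x ∈ (R.erase x).image c := by rw [hx]; simp [hcx]
    obtain ⟨x', hx', hcx'⟩ := Finset.mem_image.1 this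
    have hx'1 := Finset.mem_erase.1 hx'
    -- `x` and `x'` share a colour and the other colours are distinct, so exactly these two are
    -- removable: an even count.
    have : (R.filter fun x => (R.erase x).image c = Finset.univ.erase i₀) = {x, x'} := by
      ext w
      simp only [Finset.mem_filter, Finset.mem_insert, Finset.mem_singleton]
      constructor
      · rintro ⟨hwR, hw⟩
        by_contra! hcon
        have hwx : w ∈ R.erase x := Finset.mem_erase.2 ⟨hcon.1, hwR⟩
        have : c w ∈ (R.erase w).image c := by
          rw [hw, ← hx]; exact Finset.mem_image_of_mem c hwx
        obtain ⟨v, hv, hcv⟩ := Finset.mem_image.1 this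
        have hv1 := Finset.mem_erase.1 hv
        by_cases hvx : v = x
        · subst hvx
          exact hcon.2 (hinj hwx hx' (by rw [hcx', hcv]))
        · exact hv1.1 (hinj (Finset.mem_coe.2 (Finset.mem_erase.2 ⟨hvx, hv1.2⟩)) hwx hcv)
      · rintro (rfl | rfl)
        · exact ⟨hxR, hx⟩
        · refine ⟨hx'1.2, ?_⟩
          rw [← hx]
          ext k
          simp only [Finset.mem_image, Finset.mem_erase]
          constructor
          · rintro ⟨v, ⟨hv, hvR⟩, rfl⟩
            by_cases hvx : v = x
            · exact ⟨w, hx'1, by rw [hcx', hvx]⟩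
            · exact ⟨v, ⟨hvx, hvR⟩, rfl⟩
          · rintro ⟨v, ⟨hv, hvR⟩, rfl⟩
            by_cases hvx : v = w
            · exact ⟨x, ⟨hx'1.1.symm, hxR⟩, by rw [← hcx', hvx]⟩
            · exact ⟨v, ⟨hvx, hvR⟩, rfl⟩
    rw [this, Finset.card_pair hx'1.1.symm] at hodd
    exact absurd hodd (by decide)
  · intro himg
    have hinj : Set.InjOn c R := by
      rw [← Finset.card_image_iff, himg, hR, Finset.card_univ]
    obtain ⟨x, hxR, hx⟩ := Finset.mem_image.1 (himg ▸ Finset.mem_univ i₀)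
    have : (R.filter fun x => (R.erase x).image c = Finset.univ.erase i₀) = {x} := by
      ext w
      simp only [Finset.mem_filter, Finset.mem_singleton]
      constructor
      · rintro ⟨hwR, hw⟩
        by_contra hwx
        have : c x ∈ (R.erase w).image c :=
          Finset.mem_image_of_mem c (Finset.mem_erase.2 ⟨Ne.symm hwx, hxR⟩)
        rw [hw, hx] at this
        simp at this
      · rintro rfl
        refine ⟨hxR, ?_⟩
        ext k
        simp only [Finset.mem_image, Finset.mem_erase, Finset.mem_univ, and_true]
        constructor
        · rintro ⟨v, ⟨hv, hvR⟩, rfl⟩ hcon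
          exact hv (hinj hvR hxR (by rw [hcon, hx]))
        · intro hk
          obtain ⟨v, hvR, rfl⟩ := Finset.mem_image.1 (himg ▸ Finset.mem_univ k)
          exact ⟨v, ⟨by rintro rfl; exact hk hx, hvR⟩, rfl⟩
    rw [this]
    simp

open Classical in
/-- **Scarf's lemma**, for linear orders given by injective keys `h i` and slack points `s i`. -/
theorem exists_dominant_rainbow [Fintype X] [Nontrivial I] {h : I → X → α}
    (hinj : ∀ i, Function.Injective (h i)) {s : I → X}
    (hs_bot : ∀ i x, x ≠ s i → h i (s i) < h i x)
    (hs_top : ∀ i j x, x ∉ Set.range s → j ≠ i → h i x < h i (s j))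
    {t : X} (ht : t ∉ Set.range s) {c : X → I} (hc : ∀ i, c (s i) = i) :
    ∃ R : Finset X, Dominant h R ∧ R.image c = Finset.univ := by
  obtain ⟨i₀⟩ : Nonempty I := inferInstance
  have hsinj : Function.Injective s := fun i j hij => by rw [← hc i, hij, hc]
  have hcard2 : 1 < Fintype.card I := Fintype.one_lt_card
  -- Rooms are full-size dominant sets; doors are dominant sets one point smaller carrying all
  -- colours but `i₀`. Both sides of `hcount` count pairs of a room and one of its doors.
  set rooms : Finset (Finset X) :=
    Finset.univ.filter fun R => R.card = Fintype.card I ∧ Dominant h R with hrooms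
  set doors : Finset (Finset X) := Finset.univ.filter fun E =>
    (E.card + 1 = Fintype.card I ∧ Dominant h E) ∧ E.image c = Finset.univ.erase i₀ with hdoors
  have hcount : ∑ R ∈ rooms,
        (R.filter fun x => (R.erase x).image c = Finset.univ.erase i₀).card
      = ∑ E ∈ doors, (Finset.univ.filter fun z => z ∉ E ∧ Dominant h (insert z E)).card := by
    rw [← Finset.card_sigma, ← Finset.card_sigma]
    refine Finset.card_nbij' (fun p => ⟨p.1.erase p.2, p.2⟩) (fun p => ⟨insert p.2 p.1, p.2⟩)
      ?_ ?_ ?_ ?_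
    · rintro ⟨R, x⟩ hp
      simp only [hrooms, hdoors, Finset.coe_sigma, Set.mem_sigma_iff, Finset.mem_coe,
        Finset.mem_filter, Finset.mem_univ, true_and] at hp ⊢
      obtain ⟨⟨hR, hdom⟩, hx, himg⟩ := hp
      refine ⟨⟨⟨?_, hdom.mono (Finset.erase_subset _ _)⟩, himg⟩, by simp, ?_⟩
      · rw [Finset.card_erase_of_mem hx]; omega
      · rwa [Finset.insert_erase hx]
    · rintro ⟨E, z⟩ hp
      simp only [hrooms, hdoors, Finset.coe_sigma, Set.mem_sigma_iff, Finset.mem_coe,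
        Finset.mem_filter, Finset.mem_univ, true_and] at hp ⊢
      obtain ⟨⟨⟨hE, -⟩, himg⟩, hz, hdom⟩ := hp
      refine ⟨⟨?_, hdom⟩, Finset.mem_insert_self _ _, ?_⟩
      · rw [Finset.card_insert_of_notMem hz, hE]
      · rwa [Finset.erase_insert hz]
    · rintro ⟨R, x⟩ hp
      simp only [hrooms, Finset.coe_sigma, Set.mem_sigma_iff, Finset.mem_coe,
        Finset.mem_filter, Finset.mem_univ, true_and] at hp ⊢
      rw [Finset.insert_erase hp.2.1]
    · rintro ⟨E, z⟩ hp
      simp only [hdoors, Finset.coe_sigma, Set.mem_sigma_iff, Finset.mem_coe,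
        Finset.mem_filter, Finset.mem_univ, true_and] at hp ⊢
      rw [Finset.erase_insert hp.2.1]
  set E₀ : Finset X := (Finset.univ.erase i₀).image s with hE₀
  have hE₀_card : E₀.card + 1 = Fintype.card I := by
    rw [hE₀, Finset.card_image_of_injective _ hsinj,
      Finset.card_erase_of_mem (Finset.mem_univ _), Finset.card_univ]; omega
  have hE₀_dom : Dominant h E₀ := by
    intro y
    by_cases hy : y ∈ Set.range s
    · obtain ⟨k, rfl⟩ := hy
      by_cases hk : k = i₀
      · refine ⟨i₀, fun x _ => ?_⟩
        by_cases hx : x = s i₀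
        · rw [hx, hk]
        · rw [hk]; exact (hs_bot i₀ x hx).le
      · refine ⟨k, fun x hx => ?_⟩
        by_cases hx : x = s k
        · rw [hx]
        · exact (hs_bot k x hx).le
    · refine ⟨i₀, fun x hx => ?_⟩
      obtain ⟨k, hk, rfl⟩ := Finset.mem_image.1 hx
      exact (hs_top i₀ k y hy (by simpa using hk)).le
  have hE₀_mem : E₀ ∈ doors := by
    simp only [hdoors, Finset.mem_filter, Finset.mem_univ, true_and]
    refine ⟨⟨hE₀_card, hE₀_dom⟩, ?_⟩
    rw [hE₀, Finset.image_image]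
    have : c ∘ s = id := funext hc
    rw [this, Finset.image_id]
  have hne : ∀ E : Finset X, E.card + 1 = Fintype.card I → E.Nonempty := fun E hE => by
    rw [← Finset.card_pos]; omega
  -- `E₀` is the boundary door. Its minimum in each order `l ≠ i₀` is `s l`, so `i₀` belongs to the
  -- twin pair. Releasing `i₀` admits the point `t`; releasing the other order admits nothing, since
  -- non-slack points lie below slack points in order `i₀`.
  have hodd₀ : (Finset.univ.filter fun z => z ∉ E₀ ∧ Dominant h (insert z E₀)).card = 1 := by
    obtain ⟨m, i, j, H⟩ := exists_isTwin hinj (hne _ hE₀_card) hE₀_card hE₀_dom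
    have hm : ∀ l, l ≠ i₀ → m l = s l := by
      intro l hl
      by_contra hne
      exact absurd (H.le l (s l) (Finset.mem_image_of_mem s (by simp [hl])))
        (not_le.2 (hs_bot l _ hne))
    have main : ∀ j, IsTwin h E₀ m i₀ j →
        (Finset.univ.filter fun z => z ∉ E₀ ∧ Dominant h (insert z E₀)).card = 1 := by
      intro j H
      rw [card_extensions hinj H hE₀_dom, if_pos, if_neg]
      · rintro ⟨y, hy⟩
        have hj := hy i₀ H.ne
        rw [H.eq, hm j H.ne.symm] at hj
        by_cases hys : y ∈ Set.range s
        · obtain ⟨k, rfl⟩ := hys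
          by_cases hk : k = i₀
          · subst hk
            exact absurd hj (not_lt.2 (hs_bot k _ (hsinj.ne H.ne.symm)).le)
          · by_cases hkj : k = j
            · exact absurd hj (by rw [hkj]; exact lt_irrefl _)
            · have := hy k hkj
              rw [hm k hk] at this
              exact lt_irrefl _ this
        · exact absurd hj (not_lt.2 (hs_top i₀ j y hys H.ne.symm).le)
      · refine ⟨t, fun l hl => ?_⟩
        rw [hm l hl]
        exact hs_bot l t fun hts => ht ⟨l, hts.symm⟩
    have : i = i₀ ∨ j = i₀ := by
      by_contra! hcon
      have := H.eq
      rw [hm i hcon.1, hm j hcon.2] at this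
      exact H.ne (hsinj this)
    rcases this with rfl | rfl
    · exact main j H
    · exact main i H.symm
  -- Any other door contains a non-slack point `x`. In every order `l ≠ i` the minimum is at most
  -- `x`, which is below `s i`; so both twin orders give an extension.
  have heven : ∀ E ∈ doors, E ≠ E₀ →
      (Finset.univ.filter fun z => z ∉ E ∧ Dominant h (insert z E)).card = 2 := by
    intro E hE hEne
    simp only [hdoors, Finset.mem_filter, Finset.mem_univ, true_and] at hE
    obtain ⟨⟨hEc, hEd⟩, himg⟩ := hE
    have hx : ∃ x ∈ E, x ∉ Set.range s := by
      by_contra! hcon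
      apply hEne
      refine Finset.eq_of_subset_of_card_le (fun x hx => ?_) (by omega)
      obtain ⟨k, rfl⟩ := hcon x hx
      refine Finset.mem_image_of_mem s ?_
      have := Finset.mem_image_of_mem c hx
      rwa [himg, hc] at this
    obtain ⟨x, hxE, hxs⟩ := hx
    obtain ⟨m, i, j, H⟩ := exists_isTwin hinj (hne _ hEc) hEc hEd
    have hab : ∀ i, ∃ y, Above h m i y := fun i =>
      ⟨s i, fun l hl => (H.le l x hxE).trans_lt (hs_top l i x hxs hl.symm)⟩
    rw [card_extensions hinj H hEd, if_pos (hab i), if_pos (hab j)]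
  have hodd : Odd (∑ E ∈ doors,
      (Finset.univ.filter fun z => z ∉ E ∧ Dominant h (insert z E)).card) := by
    rw [← Finset.add_sum_erase _ _ hE₀_mem, hodd₀]
    refine Odd.add_even odd_one (Finset.even_sum _ fun E hE => ?_)
    rw [heven E (Finset.mem_of_mem_erase hE) (Finset.ne_of_mem_erase hE)]
    exact even_two
  rw [← hcount] at hodd
  have : ∃ R ∈ rooms, Odd (R.filter fun x => (R.erase x).image c = Finset.univ.erase i₀).card := by
    by_contra! hcon
    exact absurd (Finset.even_sum _ fun R hR => Nat.not_odd_iff_even.1 (hcon R hR))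
      (Nat.not_even_iff_odd.2 hodd)
  obtain ⟨R, hR, hRodd⟩ := this
  simp only [hrooms, Finset.mem_filter, Finset.mem_univ, true_and] at hR
  exact ⟨R, hR.2, (odd_card_removable hR.1).1 hRodd⟩

end Scarf

/-! ### Brouwer's fixed point theorem -/

/-- Scarf's lemma is applied to a finite net ordered by coordinates, a point `x` being coloured by
some `i` with `x i ≤ F x i`. Dominance forces the net points of the rainbow set to be close
together, and the colours provide the inequalities. -/
lemma exists_approx_fixed_point_stdSimplex {I : Type*} [Fintype I] [Nontrivial I]
    {F : (I → ℝ) → I → ℝ} (hF : MapsTo F (stdSimplex ℝ I) (stdSimplex ℝ I)) {δ : ℝ} (hδ : 0 < δ) :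
    ∃ z ∈ stdSimplex ℝ I, ∀ i, ∃ x ∈ stdSimplex ℝ I, dist x z ≤ δ ∧ x i ≤ F x i + δ := by
  classical
  have hn : (0 : ℝ) < Fintype.card I := by exact_mod_cast Fintype.card_pos
  set ε : ℝ := δ / Fintype.card I with hε
  have hε0 : 0 < ε := div_pos hδ hn
  obtain ⟨T, hTs, hTfin, hTcover⟩ := (isCompact_stdSimplex ℝ I).finite_cover_balls hε0
  have hnet : ∀ y ∈ stdSimplex ℝ I, ∃ y' : T, dist y y' < ε := fun y hy => by
    obtain ⟨y', hy', hd⟩ := mem_iUnion₂.1 (hTcover hy)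
    exact ⟨⟨y', hy'⟩, hd⟩
  have : Fintype T := hTfin.fintype
  have hcol : ∀ x : T, ∃ i, (x : I → ℝ) i ≤ F x i := by
    intro x
    by_contra! hcon
    have h1 := Finset.sum_lt_sum_of_nonempty (s := Finset.univ) Finset.univ_nonempty
      fun i _ => hcon i
    rw [(hF (hTs x.2)).2, (hTs x.2).2] at h1
    exact lt_irrefl _ h1
  choose col hcol using hcol
  -- Coordinates lie in `[0, 1]`, so `-1` puts a slack point below the net in its own order and `2`
  -- puts it above in the others. The second lexicographic component of `h` breaks ties.
  let a : I → T ⊕ I → ℝ := fun i => Sum.elim (fun x => (x : I → ℝ) i) fun j => if j = i then -1 else 2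
  let h : I → T ⊕ I → ℝ ×ₗ Fin (Fintype.card (T ⊕ I)) :=
    fun i x => toLex (a i x, Fintype.equivFin _ x)
  have ha_lt : ∀ i x y, a i x < a i y → h i x < h i y := fun i x y hxy =>
    Prod.Lex.toLex_lt_toLex.2 (Or.inl hxy)
  have ha_le : ∀ i x y, h i x ≤ h i y → a i x ≤ a i y := fun i x y hxy => by
    by_contra! hcon
    exact absurd hxy (not_le.2 (ha_lt i y x hcon))
  have hbd : ∀ (x : T) i, 0 ≤ (x : I → ℝ) i ∧ (x : I → ℝ) i ≤ 1 := fun x i =>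
    ⟨(hTs x.2).1 i, (hTs x.2).2 ▸ Finset.single_le_sum (fun j _ => (hTs x.2).1 j)
      (Finset.mem_univ i)⟩
  obtain ⟨t, -⟩ := hnet _ (single_mem_stdSimplex ℝ (Classical.arbitrary I))
  obtain ⟨R, hdom, himg⟩ := exists_dominant_rainbow (h := h) (s := Sum.inr)
    (fun i x y hxy => (Fintype.equivFin (T ⊕ I)).injective
      (congrArg Prod.snd (toLex.injective hxy)))
    (by
      rintro i (x | j) hx
      · refine ha_lt _ _ _ ?_
        simp only [a, Sum.elim_inr, Sum.elim_inl, if_true]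
        linarith [(hbd x i).1]
      · have : j ≠ i := fun h => hx (by rw [h])
        refine ha_lt _ _ _ ?_
        simp only [a, Sum.elim_inr, if_true, if_neg this]
        norm_num)
    (by
      rintro i j (x | k) hx hji
      · refine ha_lt _ _ _ ?_
        simp only [a, Sum.elim_inr, Sum.elim_inl, if_neg hji]
        linarith [(hbd x i).2]
      · exact absurd (mem_range_self k) hx)
    (t := Sum.inl t) (by simp) (c := Sum.elim col id) (fun i => rfl)
  set σ : Finset T := Finset.univ.filter fun x => Sum.inl x ∈ R with hσ
  set C : Finset I := Finset.univ.filter fun i => Sum.inr i ∉ R with hC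
  have hσC : ∀ i ∈ C, ∃ x ∈ σ, col x = i := by
    intro i hi
    obtain ⟨x, hx, hxi⟩ := Finset.mem_image.1 (himg ▸ Finset.mem_univ i)
    rcases x with x | j
    · exact ⟨x, by simpa [hσ] using hx, hxi⟩
    · simp only [Sum.elim_inr, id] at hxi
      subst hxi
      simp [hC, hx] at hi
  -- An order whose slack point lies in `R` cannot stop a net point, because that slack point has
  -- key `-1`.
  have hdomT : ∀ y : T, ∃ i ∈ C, ∀ x ∈ σ, (y : I → ℝ) i ≤ (x : I → ℝ) i := by
    intro y
    obtain ⟨i, hi⟩ := hdom (Sum.inl y)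
    refine ⟨i, ?_, fun x hx => ?_⟩
    · simp only [hC, Finset.mem_filter, Finset.mem_univ, true_and]
      intro hiR
      have := ha_le _ _ _ (hi _ hiR)
      simp only [a, Sum.elim_inr, Sum.elim_inl, if_true] at this
      linarith [(hbd y i).1]
    · exact ha_le _ _ _ (hi _ (by simpa [hσ] using hx))
  obtain ⟨i₀, hi₀, -⟩ := hdomT t
  obtain ⟨z, hzσ, -⟩ := hσC i₀ hi₀
  have hmin : ∀ i, ∃ w ∈ σ, ∀ x ∈ σ, (w : I → ℝ) i ≤ (x : I → ℝ) i := fun i =>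
    Finset.exists_min_image σ (fun x : T => (x : I → ℝ) i) ⟨z, hzσ⟩
  choose w hwσ hw using hmin
  set m : I → ℝ := fun i => (w i : I → ℝ) i with hm
  set r : ℝ := 1 - ∑ i ∈ C, m i with hr
  have hsumC : ∀ x : T, ∑ i ∈ C, (x : I → ℝ) i ≤ 1 := fun x => (hTs x.2).2 ▸
    Finset.sum_le_univ_sum_of_nonneg fun i => (hTs x.2).1 i
  have hr0 : 0 ≤ r := by
    have := Finset.sum_le_sum fun i (_ : i ∈ C) => hw i z hzσ
    linarith [hsumC z]
  have hCpos : (0 : ℝ) < C.card := by exact_mod_cast Finset.card_pos.2 ⟨i₀, hi₀⟩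
  -- Spreading the defect `r` evenly over `C` gives a point of the simplex exceeding each minimum by
  -- `r / C.card`. A net point within `ε` of it is stopped in some order of `C`, so this excess is
  -- less than `ε`.
  have hrδ : r ≤ δ := by
    obtain ⟨y', hy'⟩ := hnet (fun i => if i ∈ C then m i + r / C.card else 0) (by
      refine ⟨fun i => ?_, ?_⟩
      · dsimp only
        split_ifs
        · exact add_nonneg (hbd _ _).1 (by positivity)
        · exact le_rfl
      · rw [Finset.sum_ite_mem, Finset.univ_inter, Finset.sum_add_distrib, Finset.sum_const,
          nsmul_eq_mul, mul_div_cancel₀ _ hCpos.ne']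
        linarith)
    obtain ⟨i, hiC, hi⟩ := hdomT y'
    have h1 := (dist_le_pi_dist _ _ i).trans_lt hy'
    rw [Real.dist_eq, if_pos hiC] at h1
    have h2 : r / C.card < ε := by
      have := (abs_lt.1 h1).2
      have := hi (w i) (hwσ i)
      linarith
    rw [div_lt_iff₀ hCpos] at h2
    have h3 : (C.card : ℝ) ≤ Fintype.card I := by exact_mod_cast Finset.card_le_univ C
    calc r ≤ ε * C.card := h2.le
      _ ≤ ε * Fintype.card I := by gcongr
      _ = δ := div_mul_cancel₀ _ hn.ne'
  have hclose : ∀ x ∈ σ, ∀ i, (i ∈ C → m i ≤ (x : I → ℝ) i ∧ (x : I → ℝ) i ≤ m i + r) ∧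
      (i ∉ C → (x : I → ℝ) i ≤ r) := by
    intro x hx i
    refine ⟨fun hi => ⟨hw i x hx, ?_⟩, fun hi => ?_⟩
    · have := Finset.single_le_sum (f := fun i => (x : I → ℝ) i - m i)
        (fun j _ => sub_nonneg.2 (hw j x hx)) hi
      rw [Finset.sum_sub_distrib] at this
      linarith [hsumC x]
    · have h1 : ∑ j ∈ insert i C, (x : I → ℝ) j ≤ 1 := (hTs x.2).2 ▸
        Finset.sum_le_univ_sum_of_nonneg fun i => (hTs x.2).1 i
      rw [Finset.sum_insert hi] at h1
      have := Finset.sum_le_sum fun i (_ : i ∈ C) => hw i x hx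
      linarith
  refine ⟨z, hTs z.2, fun i => ?_⟩
  by_cases hi : i ∈ C
  · obtain ⟨x, hxσ, hxi⟩ := hσC i hi
    refine ⟨x, hTs x.2, (dist_pi_le_iff hδ.le).2 fun j => ?_, ?_⟩
    · have h1 := hclose x hxσ j
      have h2 := hclose z hzσ j
      rw [Real.dist_eq, abs_le]
      by_cases hj : j ∈ C
      · constructor <;> linarith [h1.1 hj, h2.1 hj]
      · constructor <;> linarith [h1.2 hj, h2.2 hj, (hbd x j).1, (hbd z j).1]
    · have := hcol x
      rw [hxi] at this
      linarith
  · refine ⟨z, hTs z.2, by rw [dist_self]; exact hδ.le, ?_⟩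
    linarith [(hclose z hzσ i).2 hi, (hF (hTs z.2)).1 i]

end Scarf

/-- **Brouwer's fixed point theorem** for the standard simplex. -/
theorem exists_fixed_point_stdSimplex {I : Type*} [Fintype I] [Nontrivial I]
    {F : (I → ℝ) → I → ℝ} (hF : MapsTo F (stdSimplex ℝ I) (stdSimplex ℝ I))
    (hFc : ContinuousOn F (stdSimplex ℝ I)) : ∃ x ∈ stdSimplex ℝ I, F x = x := by
  have hδ : ∀ n : ℕ, (0 : ℝ) < 1 / ((n : ℝ) + 1) := fun n => Nat.one_div_pos_of_nat
  choose z hz x hx hxz hxF using fun n => Scarf.exists_approx_fixed_point_stdSimplex hF (hδ n)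
  obtain ⟨a, ha, φ, hφ, hlim⟩ := (isCompact_stdSimplex ℝ I).tendsto_subseq hz
  have h0 : Tendsto (fun n => 1 / ((φ n : ℝ) + 1)) atTop (𝓝 0) :=
    (tendsto_one_div_add_atTop_nhds_zero_nat (𝕜 := ℝ)).comp hφ.tendsto_atTop
  have hle : ∀ i, a i ≤ F a i := by
    intro i
    have hxa : Tendsto (fun n => x (φ n) i) atTop (𝓝 a) := by
      refine tendsto_of_tendsto_of_dist hlim ?_
      refine squeeze_zero (fun _ => dist_nonneg) (fun n => ?_) h0
      rw [dist_comm]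
      exact hxz (φ n) i
    have hFa : Tendsto (fun n => F (x (φ n) i)) atTop (𝓝 (F a)) :=
      (hFc a ha).tendsto.comp
        (tendsto_nhdsWithin_iff.2 ⟨hxa, Eventually.of_forall fun n => hx (φ n) i⟩)
    have h1 : Tendsto (fun n => F (x (φ n) i) i + 1 / ((φ n : ℝ) + 1)) atTop (𝓝 (F a i + 0)) :=
      ((tendsto_pi_nhds.1 hFa) i).add h0
    rw [add_zero] at h1
    exact le_of_tendsto_of_tendsto' ((tendsto_pi_nhds.1 hxa) i) h1 fun n => hxF (φ n) i
  refine ⟨a, ha, funext fun i => ?_⟩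
  -- Coordinatewise `a ≤ F a` with equal sums forces equality.
  have hsum : ∑ i, a i = ∑ i, F a i := by rw [ha.2, (hF ha).2]
  exact ((Finset.sum_eq_sum_iff_of_le fun i _ => hle i).1 hsum i (Finset.mem_univ i)).symm

/-- A continuous self-map of a finite-dimensional space with values in a cube has a fixed point. -/
theorem exists_fixed_point_of_abs_le {ι : Type*} [Fintype ι] [Nonempty ι]
    {F : (ι → ℝ) → ι → ℝ} (hF : Continuous F) {M : ℝ} (hM : ∀ x i, |F x i| ≤ M) :
    ∃ x, F x = x := by
  have hM0 : 0 ≤ M := (abs_nonneg _).trans (hM 0 (Classical.arbitrary ι))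
  -- The cube is rescaled into the simplex, with `none` as the coordinate taking the remaining mass.
  -- Each rescaled coordinate is at most `2 * M / K`, so their sum is at most one; `M + 1` keeps `K`
  -- positive when `M = 0`.
  set K : ℝ := 2 * (M + 1) * Fintype.card ι with hK
  have hn : (0 : ℝ) < Fintype.card ι := by exact_mod_cast Fintype.card_pos
  have hK0 : 0 < K := by positivity
  let e : (Option ι → ℝ) → ι → ℝ := fun x i => K * x (some i) - M
  let G : (Option ι → ℝ) → Option ι → ℝ := fun x o =>
    o.elim (1 - ∑ i, (F (e x) i + M) / K) fun i => (F (e x) i + M) / K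
  have he : Continuous e := by fun_prop
  have hG : Continuous G := by
    refine continuous_pi fun o => ?_
    have hFi : ∀ i, Continuous fun x => F (e x) i := fun i =>
      (continuous_apply i).comp (hF.comp he)
    rcases o with _ | i
    · exact continuous_const.sub
        (continuous_finsetSum _ fun i _ => ((hFi i).add continuous_const).div_const _)
    · exact ((hFi i).add continuous_const).div_const _
  obtain ⟨x, -, hx⟩ := exists_fixed_point_stdSimplex (F := G) (fun x _ => by
    refine ⟨fun o => ?_, ?_⟩
    · rcases o with _ | i
      · have : ∑ i, (F (e x) i + M) / K ≤ ∑ _i : ι, 2 * (M + 1) / K := by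
          gcongr with i
          linarith [(abs_le.1 (hM (e x) i)).2]
        rw [Finset.sum_const, nsmul_eq_mul, Finset.card_univ] at this
        have h1 : (Fintype.card ι : ℝ) * (2 * (M + 1) / K) = 1 := by
          rw [hK]; field_simp
        simp only [G, Option.elim]
        linarith
      · simp only [G, Option.elim]
        exact div_nonneg (by linarith [(abs_le.1 (hM (e x) i)).1]) hK0.le
    · rw [Fintype.sum_option]
      simp [G]) hG.continuousOn
  refine ⟨e x, funext fun i => ?_⟩
  have := congrFun hx (some i)
  simp only [G, Option.elim] at this
  simp only [e, ← this]
  field_simp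
  simp

namespace RelaxedMDP

/-! ### The matrix exponential of the generator -/

section Semigroup

attribute [local instance] Matrix.linftyOpNormedRing Matrix.linftyOpNormedAlgebra

variable {d : ℕ} (Q : Matrix (Fin d) (Fin d) ℝ)

/-- The entries of the semigroup generated by `Q`. -/
noncomputable def semigroup (Q : Matrix (Fin d) (Fin d) ℝ) (t : ℝ) (i j : Fin d) : ℝ :=
  (NormedSpace.exp (t • Q) : Matrix (Fin d) (Fin d) ℝ) i j

lemma semigroup_zero (i j : Fin d) : semigroup Q 0 i j = if i = j then 1 else 0 := by
  simp [semigroup, Matrix.one_apply]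

lemma semigroup_add (s t : ℝ) (i j : Fin d) :
    semigroup Q (s + t) i j = ∑ k, semigroup Q s i k * semigroup Q t k j := by
  have : Commute (s • Q) (t • Q) := ((Commute.refl Q).smul_left s).smul_right t
  simp only [semigroup]
  rw [add_smul, Matrix.exp_add_of_commute _ _ this, Matrix.mul_apply]

/-- Kolmogorov's backward equation; the primed version is the forward equation. -/
lemma hasDerivAt_semigroup (t : ℝ) (i j : Fin d) :
    HasDerivAt (fun t => semigroup Q t i j) (∑ k, Q i k * semigroup Q t k j) t := by
  have h := hasDerivAt_exp_smul_const' (𝕂 := ℝ) Q t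
  have h1 := (hasDerivAt_pi.1 ((hasDerivAt_pi.1 h) i)) j
  exact h1

lemma hasDerivAt_semigroup' (t : ℝ) (i j : Fin d) :
    HasDerivAt (fun t => semigroup Q t i j) (∑ k, semigroup Q t i k * Q k j) t := by
  have h := hasDerivAt_exp_smul_const (𝕂 := ℝ) Q t
  have h1 := (hasDerivAt_pi.1 ((hasDerivAt_pi.1 h) i)) j
  exact h1

lemma continuous_semigroup (i j : Fin d) : Continuous fun t => semigroup Q t i j :=
  continuous_iff_continuousAt.2 fun t => (hasDerivAt_semigroup Q t i j).continuousAt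

lemma continuous_semigroup_generator {Z : Type*} [TopologicalSpace Z]
    {R : Z → Matrix (Fin d) (Fin d) ℝ} (hR : ∀ i j, Continuous fun z => R z i j) (t : ℝ)
    (i j : Fin d) : Continuous fun z => semigroup (R z) t i j := by
  have hR' : Continuous R := continuous_pi fun i => continuous_pi fun j => hR i j
  have h : Continuous fun z => (NormedSpace.exp (t • R z) : Matrix (Fin d) (Fin d) ℝ) :=
    NormedSpace.exp_continuous.comp (hR'.const_smul t)
  exact (continuous_apply j).comp ((continuous_apply i).comp h)

end Semigroup

/-! ### Rate matrices and their jump laws -/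

section RateMatrix

variable {d : ℕ} {Q : Matrix (Fin d) (Fin d) ℝ}

lemma IsRateMatrix.sum_eq_zero (hQ : IsRateMatrix Q) (i : Fin d) : ∑ j, Q i j = 0 := by
  rw [← Finset.add_sum_erase _ _ (Finset.mem_univ i), hQ.2 i]
  ring

lemma IsRateMatrix.neg_diag_nonneg (hQ : IsRateMatrix Q) (i : Fin d) : 0 ≤ -Q i i := by
  rw [hQ.2 i, neg_neg]
  exact Finset.sum_nonneg fun j hj => hQ.1 i j (Finset.ne_of_mem_erase hj)

lemma IsRateMatrix.sum_semigroup (hQ : IsRateMatrix Q) (t : ℝ) (i : Fin d) :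
    ∑ j, semigroup Q t i j = 1 := by
  have hd : ∀ t, HasDerivAt (fun t => ∑ j, semigroup Q t i j) 0 t := by
    intro t
    have h := HasDerivAt.fun_sum (u := Finset.univ) fun j _ => hasDerivAt_semigroup' Q t i j
    rw [Finset.sum_comm] at h
    simpa only [← Finset.mul_sum, hQ.sum_eq_zero, mul_zero, Finset.sum_const_zero] using h
  have := is_const_of_deriv_eq_zero (fun t => (hd t).differentiableAt) (fun t => (hd t).deriv) t 0
  simpa [semigroup_zero] using this

lemma IsRateMatrix.semigroup_of_absorbing (hQ : IsRateMatrix Q) {i : Fin d} (hi : Q i i = 0)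
    (t : ℝ) (j : Fin d) : semigroup Q t i j = if i = j then 1 else 0 := by
  have hrow : ∀ k, Q i k = 0 := by
    have h0 : ∑ j ∈ Finset.univ.erase i, Q i j = 0 := by have := hQ.2 i; linarith
    intro k
    by_cases hk : k = i
    · rw [hk, hi]
    · exact (Finset.sum_eq_zero_iff_of_nonneg
        fun j hj => hQ.1 i j (Finset.ne_of_mem_erase hj)).1 h0 k (by simp [hk])
  have hd : ∀ t, HasDerivAt (fun t => semigroup Q t i j) 0 t := fun t => by
    simpa [hrow] using hasDerivAt_semigroup Q t i j
  have := is_const_of_deriv_eq_zero (fun t => (hd t).differentiableAt) (fun t => (hd t).deriv) t 0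
  simpa [semigroup_zero] using this

lemma IsRateMatrix.tsum_ofReal (hQ : IsRateMatrix Q) (i : Fin d) :
    (∑' j, if j = i then 0 else ENNReal.ofReal (Q i j)) = ENNReal.ofReal (-Q i i) := by
  rw [tsum_fintype, hQ.2 i, neg_neg, ENNReal.ofReal_sum_of_nonneg
    fun j hj => hQ.1 i j (Finset.ne_of_mem_erase hj), ← Finset.add_sum_erase _ _ (Finset.mem_univ i),
    if_pos rfl, zero_add]
  exact Finset.sum_congr rfl fun j hj => if_neg (Finset.ne_of_mem_erase hj)

lemma IsRateMatrix.mul_jumpPMF (hQ : IsRateMatrix Q) {i : Fin d} (hi : 0 < -Q i i) (k : Fin d) :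
    -Q i i * (jumpPMF Q i k).toReal = if k = i then 0 else Q i k := by
  have h0 : ¬ (∑' j, if j = i then 0 else ENNReal.ofReal (Q i j)) = 0 := by
    rw [hQ.tsum_ofReal, ENNReal.ofReal_eq_zero]; linarith
  rw [jumpPMF, dif_neg h0, PMF.normalize_apply, hQ.tsum_ofReal]
  split_ifs with hk
  · simp
  · rw [ENNReal.toReal_mul, ENNReal.toReal_inv, ENNReal.toReal_ofReal hi.le,
      ENNReal.toReal_ofReal (hQ.1 i k hk), mul_comm (Q i k), mul_inv_cancel_left₀ hi.ne']

lemma sum_jumpPMF (Q : Matrix (Fin d) (Fin d) ℝ) (i : Fin d) :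
    ∑ k, (jumpPMF Q i k).toReal = 1 := by
  rw [← ENNReal.toReal_sum fun k _ => (jumpPMF Q i).apply_ne_top k, ← tsum_fintype (L := .unconditional _),
    (jumpPMF Q i).tsum_coe, ENNReal.toReal_one]

end RateMatrix

/-! ### Integrals against the standard exponential law -/

section Exponential

lemma measurable_exponentialPDF (r : ℝ) : Measurable (exponentialPDF r) :=
  (measurable_exponentialPDFReal r).ennreal_ofReal

lemma integral_expMeasure_one (g : ℝ → ℝ) :
    ∫ x, g x ∂(expMeasure 1) = ∫ x in Ioi (0 : ℝ), Real.exp (-x) * g x := by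
  have h : expMeasure 1 = volume.withDensity (exponentialPDF 1) := rfl
  rw [h, integral_withDensity_eq_integral_toReal_smul
    (measurable_exponentialPDF 1) (by simp [exponentialPDF]),
    ← integral_Ici_eq_integral_Ioi, ← integral_indicator measurableSet_Ici]
  congr 1
  ext x
  by_cases hx : 0 ≤ x
  · rw [indicator_of_mem (mem_Ici.2 hx), exponentialPDF_of_nonneg hx,
      ENNReal.toReal_ofReal (by positivity)]
    simp
  · rw [indicator_of_notMem (by simpa using hx), exponentialPDF_of_neg (not_le.1 hx)]
    simp

lemma ae_pos_expMeasure_one : ∀ᵐ x ∂(expMeasure 1), 0 < x := by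
  have h : expMeasure 1 = volume.withDensity (exponentialPDF 1) := rfl
  rw [h, ae_withDensity_iff (measurable_exponentialPDF 1)]
  have h0 : ∀ᵐ x : ℝ, x ≠ 0 := by simp [ae_iff]
  filter_upwards [h0] with x hx hpdf
  by_contra hcon
  exact hpdf (exponentialPDF_of_neg (lt_of_le_of_ne (not_lt.1 hcon) hx))

lemma integral_expMeasure_one_ite {c : ℝ} (hc : 0 ≤ c) (a : ℝ) {g : ℝ → ℝ} (hg : Continuous g) :
    ∫ x, (if c < x then a else g x) ∂(expMeasure 1)
      = Real.exp (-c) * a + ∫ x in (0 : ℝ)..c, Real.exp (-x) * g x := by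
  rw [integral_expMeasure_one, ← Ioc_union_Ioi_eq_Ioi hc, setIntegral_union
    (Ioc_disjoint_Ioi le_rfl) measurableSet_Ioi, intervalIntegral.integral_of_le hc, add_comm]
  · congr 1
    · rw [setIntegral_congr_fun measurableSet_Ioi (g := fun x => Real.exp (-x) * a)
        (fun x hx => by simp only [if_pos (mem_Ioi.1 hx)]), integral_mul_const,
        integral_exp_neg_Ioi]
    · exact setIntegral_congr_fun measurableSet_Ioc
        fun x hx => by simp only [if_neg (not_lt.2 hx.2)]
  · refine IntegrableOn.congr_fun (f := fun x => Real.exp (-x) * g x) ?_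
      (fun x hx => by simp only [if_neg (not_lt.2 hx.2)]) measurableSet_Ioc
    exact (Continuous.integrableOn_Ioc (by fun_prop))
  · refine IntegrableOn.congr_fun (f := fun x => Real.exp (-x) * a) ?_
      (fun x hx => by simp only [if_pos (mem_Ioi.1 hx)]) measurableSet_Ioi
    exact (integrableOn_exp_neg_Ioi c).mul_const a

end Exponential

/-! ### First-step equation for the semigroup -/

section FirstStepSemigroup

variable {d : ℕ} {Q : Matrix (Fin d) (Fin d) ℝ}

/-- With `r = -Q i i > 0`, the backward equation makes `-(exp (-x) * semigroup Q (t - x / r) i j)`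
an antiderivative of the integrand over `0 ≤ x ≤ r * t`. Its value at `x = r * t` cancels the
no-jump term. -/
lemma IsRateMatrix.semigroup_first_step (hQ : IsRateMatrix Q) {t : ℝ} (ht : 0 ≤ t) (i j : Fin d) :
    semigroup Q t i j = ∫ x, (if -Q i i * t < x then (if i = j then 1 else 0) else
      ∑ k, (jumpPMF Q i k).toReal * semigroup Q (t - x / -Q i i) k j) ∂(expMeasure 1) := by
  have hcont : ∀ k, Continuous fun x : ℝ => semigroup Q (t - x / -Q i i) k j := fun k =>
    (continuous_semigroup Q k j).comp (by fun_prop)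
  rw [integral_expMeasure_one_ite (mul_nonneg (hQ.neg_diag_nonneg i) ht) _ (by fun_prop)]
  rcases (hQ.neg_diag_nonneg i).eq_or_lt with h0 | hpos
  · rw [hQ.semigroup_of_absorbing (by linarith), ← h0]
    simp
  · have hd : ∀ x, HasDerivAt (fun x => -(Real.exp (-x) * semigroup Q (t - x / -Q i i) i j))
        (Real.exp (-x) * ∑ k, (jumpPMF Q i k).toReal * semigroup Q (t - x / -Q i i) k j) x := by
      intro x
      have h1 : HasDerivAt (fun x => t - x / -Q i i) (-(1 / -Q i i)) x :=
        ((hasDerivAt_id x).div_const _).const_sub t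
      have h2 := (hasDerivAt_semigroup Q (t - x / -Q i i) i j).comp x h1
      have h3 := (((hasDerivAt_id x).neg.exp).mul h2).neg
      refine h3.congr_deriv ?_
      have hsum : ∑ k, (jumpPMF Q i k).toReal * semigroup Q (t - x / -Q i i) k j
          = (1 / -Q i i) * (∑ k, Q i k * semigroup Q (t - x / -Q i i) k j
            - Q i i * semigroup Q (t - x / -Q i i) i j) := by
        rw [← Finset.add_sum_erase Finset.univ (fun k => Q i k * _) (Finset.mem_univ i),
          ← Finset.add_sum_erase Finset.univ (fun k => (jumpPMF Q i k).toReal * _)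
            (Finset.mem_univ i), add_sub_cancel_left, Finset.mul_sum]
        have hJ : ∀ k, (jumpPMF Q i k).toReal = (1 / -Q i i) * (if k = i then 0 else Q i k) :=
          fun k => by
            rw [← hQ.mul_jumpPMF hpos, ← mul_assoc, one_div_mul_cancel hpos.ne', one_mul]
        rw [hJ i, if_pos rfl, mul_zero, zero_mul, zero_add]
        exact Finset.sum_congr rfl fun k hk => by
          rw [hJ k, if_neg (Finset.ne_of_mem_erase hk), mul_assoc]
      simp only [Pi.neg_apply, id, Function.comp]
      rw [hsum]
      have : Q i i ≠ 0 := by linarith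
      field_simp
      ring
    rw [intervalIntegral.integral_eq_sub_of_hasDerivAt (fun x _ => hd x)
      (Continuous.intervalIntegrable (by fun_prop) _ _), mul_div_cancel_left₀ _ hpos.ne', sub_self,
      semigroup_zero]
    simp

end FirstStepSemigroup

/-! ### Path decomposition at the first jump -/

section Paths

variable {d : ℕ} (Q : Matrix (Fin d) (Fin d) ℝ)

/-- The noise whose first step is `a` and whose later steps are those of `ω`. -/
def consNoise (a : ℝ × (Fin d → Fin d)) (ω : Noise d) : Noise d
  | 0 => a
  | n + 1 => ω n

/-- The chain has not exploded by time `t`. -/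
def Alive (i : Fin d) (t : ℝ) (ω : Noise d) : Prop :=
  ∃ n, ENNReal.ofReal t < jumpTime Q i ω (n + 1)

instance (Q : Matrix (Fin d) (Fin d) ℝ) : IsProbabilityMeasure (noiseLaw Q) := by
  unfold noiseLaw
  infer_instance

lemma visited_consNoise_succ (i : Fin d) (a : ℝ × (Fin d → Fin d)) (ω : Noise d) (n : ℕ) :
    visited i (consNoise a ω) (n + 1) = visited (a.2 i) ω n := by
  induction n with
  | zero => rfl
  | succ n ih => rw [visited, ih]; rfl

lemma jumpTime_consNoise_succ (i : Fin d) (a : ℝ × (Fin d → Fin d)) (ω : Noise d) (n : ℕ) :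
    jumpTime Q i (consNoise a ω) (n + 1)
      = ENNReal.ofReal a.1 / ENNReal.ofReal (-Q i i) + jumpTime Q (a.2 i) ω n := by
  rw [jumpTime, Finset.sum_range_succ', add_comm]
  congr 1
  refine Finset.sum_congr rfl fun k _ => ?_
  rw [holdingTime, visited_consNoise_succ]
  rfl

lemma ofReal_lt_ofReal_div {t x r : ℝ} (ht : 0 ≤ t) (hx : 0 < x) (hr : 0 ≤ r) :
    ENNReal.ofReal t < ENNReal.ofReal x / ENNReal.ofReal r ↔ r * t < x := by
  rcases hr.eq_or_lt with rfl | hr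
  · have : ENNReal.ofReal x ≠ 0 := by simpa using hx
    simp [ENNReal.div_zero this, hx]
  · rw [← ENNReal.ofReal_div_of_pos hr, ENNReal.ofReal_lt_ofReal_iff_of_nonneg ht, lt_div_iff₀ hr,
      mul_comm]

lemma ofReal_lt_ofReal_div_add {t x r : ℝ} (hx : 0 < x) (hr : 0 < r)
    (hxt : x ≤ r * t) (T : ℝ≥0∞) :
    ENNReal.ofReal t < ENNReal.ofReal x / ENNReal.ofReal r + T ↔
      ENNReal.ofReal (t - x / r) < T := by
  have h0 : 0 ≤ x / r := by positivity
  have h1 : 0 ≤ t - x / r := by rw [sub_nonneg, div_le_iff₀ hr, mul_comm]; exact hxt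
  rw [← ENNReal.ofReal_div_of_pos hr]
  conv_lhs => rw [← add_sub_cancel (x / r) t, ENNReal.ofReal_add h0 h1]
  exact ENNReal.add_lt_add_iff_left ENNReal.ofReal_ne_top

/-- After the first jump the path is that of the shifted noise, with all jump indices lowered by
one. `Alive` is carried along because on an exploded path the infimum of the empty set is `0`, and
the index shift fails. -/
lemma alive_and_chain_consNoise {i : Fin d} (hi : 0 ≤ -Q i i) {t x : ℝ} (ht : 0 ≤ t) (hx : 0 < x)
    (g : Fin d → Fin d) (ω : Noise d) (j : Fin d) :
    (Alive Q i t (consNoise (x, g) ω) ∧ chain Q i t (consNoise (x, g) ω) = j) ↔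
      if -Q i i * t < x then i = j
      else Alive Q (g i) (t - x / -Q i i) ω ∧ chain Q (g i) (t - x / -Q i i) ω = j := by
  set P : ℕ → Prop := fun n => ENNReal.ofReal t < jumpTime Q i (consNoise (x, g) ω) (n + 1) with hP
  have hP0 : P 0 ↔ -Q i i * t < x := by
    rw [hP]
    dsimp only
    rw [jumpTime_consNoise_succ, jumpTime, Finset.sum_range_zero, add_zero,
      ofReal_lt_ofReal_div ht hx hi]
  split_ifs with hlt
  · have h0 : P 0 := hP0.2 hlt
    have hinf : sInf {n | P n} = 0 := Nat.sInf_eq_zero.2 (Or.inl h0)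
    have hchain : chain Q i t (consNoise (x, g) ω) = i := by
      rw [chain, hinf, visited]
    rw [hchain, and_iff_right_iff_imp]
    exact fun _ => ⟨0, h0⟩
  · have hn0 : ¬ P 0 := fun h => hlt (hP0.1 h)
    have hpos : 0 < -Q i i := by
      rcases hi.eq_or_lt with h | h
      · rw [← h, zero_mul] at hlt
        exact absurd hx hlt
      · exact h
    have hPs : ∀ n, P (n + 1) ↔
        ENNReal.ofReal (t - x / -Q i i) < jumpTime Q (g i) ω (n + 1) := fun n => by
      rw [hP]
      dsimp only
      rw [jumpTime_consNoise_succ, ofReal_lt_ofReal_div_add hx hpos (not_lt.1 hlt)]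
    have halive : Alive Q i t (consNoise (x, g) ω) ↔ Alive Q (g i) (t - x / -Q i i) ω := by
      constructor
      · rintro ⟨n, hn⟩
        rcases n with _ | n
        · exact absurd hn hn0
        · exact ⟨n, (hPs n).1 hn⟩
      · rintro ⟨n, hn⟩
        exact ⟨n + 1, (hPs n).2 hn⟩
    rw [halive]
    refine and_congr_right fun hal => ?_
    obtain ⟨n, hn⟩ := halive.2 hal
    have hinf : 0 < sInf {n | P n} := Nat.pos_of_ne_zero fun h => by
      rcases Nat.sInf_eq_zero.1 h with h | h
      · exact hn0 h
      · exact (h ▸ (show n ∈ {n | P n} from hn) : n ∈ (∅ : Set ℕ))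
    have hs : sInf {n | P n}
        = sInf {n | ENNReal.ofReal (t - x / -Q i i) < jumpTime Q (g i) ω (n + 1)} + 1 := by
      rw [← Nat.sInf_add (n := 1) (p := P) hinf]
      simp_rw [hPs]
    rw [chain, hs, visited_consNoise_succ, chain]

end Paths

/-! ### Measurability of the chain -/

section Measurability

variable {d : ℕ} (Q : Matrix (Fin d) (Fin d) ℝ)

lemma measurable_visited (i : Fin d) (n : ℕ) : Measurable fun ω : Noise d => visited i ω n := by
  induction n with
  | zero => exact measurable_const
  | succ n ih =>
    have h : Measurable fun p : (Fin d → Fin d) × Fin d => p.1 p.2 :=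
      measurable_from_prod_countable_left fun k => measurable_pi_apply k
    exact h.comp ((measurable_snd.comp (measurable_pi_apply n)).prodMk ih)

lemma measurable_jumpTime (i : Fin d) (n : ℕ) :
    Measurable fun ω : Noise d => jumpTime Q i ω n := by
  refine Finset.measurable_fun_sum _ fun k _ => ?_
  have h : Measurable fun j : Fin d => ENNReal.ofReal (-Q j j) := measurable_of_finite _
  exact (ENNReal.measurable_ofReal.comp (measurable_fst.comp (measurable_pi_apply k))).div
    (h.comp (measurable_visited i k))

lemma measurableSet_lt_jumpTime (i : Fin d) (n : ℕ) :
    MeasurableSet {p : ℝ × Noise d | ENNReal.ofReal p.1 < jumpTime Q i p.2 n} :=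
  measurableSet_lt (ENNReal.measurable_ofReal.comp measurable_fst)
    ((measurable_jumpTime Q i n).comp measurable_snd)

lemma measurableSet_alive (i : Fin d) : MeasurableSet {p : ℝ × Noise d | Alive Q i p.1 p.2} := by
  have : {p : ℝ × Noise d | Alive Q i p.1 p.2}
      = ⋃ n, {p | ENNReal.ofReal p.1 < jumpTime Q i p.2 (n + 1)} := by
    ext p; simp [Alive]
  rw [this]
  exact MeasurableSet.iUnion fun n => measurableSet_lt_jumpTime Q i (n + 1)

lemma measurable_sInf_nat {Z : Type*} [MeasurableSpace Z] {P : ℕ → Z → Prop}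
    (hP : ∀ n, MeasurableSet {z | P n z}) : Measurable fun z => sInf {n | P n z} := by
  classical
  refine measurable_to_countable' fun m => ?_
  -- Either `m` is the first index satisfying `P`, or there is none and `m` is the default value
  -- `0`.
  have : (fun z => sInf {n | P n z}) ⁻¹' {m} =
      ({z | P m z} ∩ ⋂ k < m, {z | P k z}ᶜ) ∪ (⋂ n, {z | P n z}ᶜ) ∩ {_z | m = 0} := by
    ext z
    simp only [mem_preimage, mem_singleton_iff, mem_union, mem_inter_iff, mem_ofPred_eq,
      mem_iInter, mem_compl_iff]
    constructor
    · intro h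
      by_cases hne : {n | P n z}.Nonempty
      · left
        subst h
        exact ⟨Nat.sInf_mem hne, fun k hk => Nat.notMem_of_lt_sInf hk⟩
      · right
        rw [Set.not_nonempty_iff_eq_empty] at hne
        refine ⟨fun n hn => ?_, ?_⟩
        · exact (hne ▸ (show n ∈ {n | P n z} from hn) : n ∈ (∅ : Set ℕ))
        · rw [← h, hne, Nat.sInf_empty]
    · rintro (⟨h1, h2⟩ | ⟨h1, rfl⟩)
      · refine le_antisymm (Nat.sInf_le h1) ?_
        by_contra! hcon
        exact h2 _ hcon (Nat.sInf_mem (s := {n | P n z}) ⟨m, h1⟩)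
      · exact Nat.sInf_eq_zero.2 (Or.inr (Set.eq_empty_of_forall_notMem h1))
  rw [this]
  exact ((hP m).inter (MeasurableSet.biInter (Set.to_countable _) fun k _ => (hP k).compl)).union
    ((MeasurableSet.iInter fun n => (hP n).compl).inter (MeasurableSet.const _))

lemma measurable_chain (i : Fin d) : Measurable fun p : ℝ × Noise d => chain Q i p.1 p.2 := by
  have h1 : Measurable fun p : ℝ × Noise d =>
      sInf {n : ℕ | ENNReal.ofReal p.1 < jumpTime Q i p.2 (n + 1)} :=
    measurable_sInf_nat fun n => measurableSet_lt_jumpTime Q i (n + 1)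
  have h2 : Measurable fun q : Noise d × ℕ => visited i q.1 q.2 :=
    measurable_from_prod_countable_left fun n => measurable_visited i n
  exact h2.comp (measurable_snd.prodMk h1)

lemma measurable_consNoise :
    Measurable fun p : (ℝ × (Fin d → Fin d)) × Noise d => consNoise p.1 p.2 := by
  refine measurable_pi_lambda _ fun n => ?_
  rcases n with _ | n
  · exact measurable_fst
  · exact (measurable_pi_apply n).comp measurable_snd

end Measurability

/-! ### First-step equation for the chain -/

section FirstStep

variable {d : ℕ} {Q : Matrix (Fin d) (Fin d) ℝ}

/-- The law of one step of the noise. -/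
noncomputable def stepLaw (Q : Matrix (Fin d) (Fin d) ℝ) : Measure (ℝ × (Fin d → Fin d)) :=
  (expMeasure 1).prod (Measure.pi fun i : Fin d => (jumpPMF Q i).toMeasure)

instance (Q : Matrix (Fin d) (Fin d) ℝ) : IsProbabilityMeasure (stepLaw Q) := by
  unfold stepLaw
  infer_instance

/-- The steps are independent with a common law, so prefixing an independent one changes nothing; on
cylinders this is splitting off the factor of index `0`. -/
lemma map_consNoise (Q : Matrix (Fin d) (Fin d) ℝ) :
    ((stepLaw Q).prod (noiseLaw Q)).map (fun p => consNoise p.1 p.2) = noiseLaw Q := by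
  have hdef : noiseLaw Q = Measure.infinitePi fun _ : ℕ => stepLaw Q := rfl
  conv_rhs => rw [hdef]
  refine Measure.eq_infinitePi (fun _ : ℕ => stepLaw Q) fun s t ht => ?_
  classical
  have hs : MeasurableSet ((s : Set ℕ).pi t) := MeasurableSet.pi s.countable_toSet fun i _ => ht i
  rw [Measure.map_apply measurable_consNoise hs]
  set s' : Finset ℕ := s.preimage Nat.succ Nat.succ_injective.injOn with hs'
  have hpre : (fun p : (ℝ × (Fin d → Fin d)) × Noise d => consNoise p.1 p.2) ⁻¹' (s : Set ℕ).pi t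
      = (if 0 ∈ s then t 0 else univ) ×ˢ (s' : Set ℕ).pi fun n => t (n + 1) := by
    ext ⟨a, ω⟩
    simp only [mem_preimage, mem_prod, Set.mem_pi, Finset.mem_coe, hs', Finset.mem_preimage]
    constructor
    · intro h
      refine ⟨?_, fun n hn => h (n + 1) hn⟩
      split_ifs with h0
      · exact h 0 h0
      · exact mem_univ _
    · rintro ⟨h0, h1⟩ n hn
      rcases n with _ | n
      · rwa [if_pos hn] at h0
      · exact h1 n hn
  rw [hpre, Measure.prod_prod, hdef, Measure.infinitePi_pi _ fun i _ => ht (i + 1)]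
  have hprod : ∏ n ∈ s', stepLaw Q (t (n + 1)) = ∏ n ∈ s.erase 0, stepLaw Q (t n) := by
    refine Finset.prod_nbij (fun n => n + 1) ?_ ?_ ?_ fun _ _ => rfl
    · intro n hn
      simpa [hs'] using hn
    · exact fun a _ b _ hab => Nat.succ_injective hab
    · intro n hn
      simp only [Finset.coe_erase, Set.mem_sdiff, Finset.mem_coe, mem_singleton_iff] at hn
      obtain ⟨m, rfl⟩ := Nat.exists_eq_succ_of_ne_zero hn.2
      exact ⟨m, by simpa [hs'] using hn.1, rfl⟩
  rw [hprod]
  split_ifs with h0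
  · rw [Finset.mul_prod_erase s (fun n => stepLaw Q (t n)) h0]
  · rw [measure_univ, one_mul, Finset.erase_eq_of_notMem h0]

/-- The probability that the chain started at `i` has not exploded and is at `j` at time `t`. -/
noncomputable def aliveProb (Q : Matrix (Fin d) (Fin d) ℝ) (t : ℝ) (i j : Fin d) : ℝ :=
  (noiseLaw Q).real {ω | Alive Q i t ω ∧ chain Q i t ω = j}

lemma measurableSet_alive_and_chain (Q : Matrix (Fin d) (Fin d) ℝ) (i j : Fin d) :
    MeasurableSet {p : ℝ × Noise d | Alive Q i p.1 p.2 ∧ chain Q i p.1 p.2 = j} :=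
  (measurableSet_alive Q i).inter (measurable_chain Q i (measurableSet_singleton j))

lemma measurable_aliveProb (Q : Matrix (Fin d) (Fin d) ℝ) (i j : Fin d) :
    Measurable fun t => aliveProb Q t i j :=
  (measurable_measure_prodMk_left (measurableSet_alive_and_chain Q i j)).ennreal_toReal

lemma integral_jumpPMF (Q : Matrix (Fin d) (Fin d) ℝ) (i : Fin d) (φ : Fin d → ℝ) :
    ∫ g, φ (g i) ∂(Measure.pi fun i : Fin d => (jumpPMF Q i).toMeasure)
      = ∑ k, (jumpPMF Q i k).toReal * φ k := by
  have h := measurePreserving_eval (fun i : Fin d => (jumpPMF Q i).toMeasure) i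
  have h2 := integral_map (μ := Measure.pi fun i : Fin d => (jumpPMF Q i).toMeasure)
    (f := φ) h.measurable.aemeasurable (measurable_of_finite φ).aestronglyMeasurable
  rw [h.map_eq, PMF.integral_eq_sum] at h2
  simpa only [Function.eval, smul_eq_mul] using h2.symm

/-- Conditioning on the first step, by `map_consNoise` and `alive_and_chain_consNoise`. This is the
equation of `IsRateMatrix.semigroup_first_step`. -/
lemma IsRateMatrix.aliveProb_first_step (hQ : IsRateMatrix Q) {t : ℝ} (ht : 0 ≤ t)
    (i j : Fin d) :
    aliveProb Q t i j = ∫ x, (if -Q i i * t < x then (if i = j then 1 else 0) else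
      ∑ k, (jumpPMF Q i k).toReal * aliveProb Q (t - x / -Q i i) k j) ∂(expMeasure 1) := by
  have hS : MeasurableSet {ω : Noise d | Alive Q i t ω ∧ chain Q i t ω = j} :=
    measurable_prodMk_left (measurableSet_alive_and_chain Q i j)
  set Φ : ℝ × (Fin d → Fin d) → ℝ := fun a => if -Q i i * t < a.1 then (if i = j then 1 else 0)
    else aliveProb Q (t - a.1 / -Q i i) (a.2 i) j with hΦ
  have hΦm : Measurable Φ := by
    refine Measurable.ite (measurableSet_lt measurable_const measurable_fst) measurable_const ?_
    have h : Measurable fun p : ℝ × Fin d => aliveProb Q p.1 p.2 j :=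
      measurable_from_prod_countable_left fun k => measurable_aliveProb Q k j
    exact h.comp (f := fun a : ℝ × (Fin d → Fin d) => (t - a.1 / -Q i i, a.2 i))
      ((measurable_const.sub (measurable_fst.div_const _)).prodMk
      ((measurable_pi_apply i).comp measurable_snd))
  have hΦb : ∀ a, ‖Φ a‖ ≤ 1 := by
    intro a
    simp only [hΦ]
    split_ifs
    · simp
    · simp
    · exact (Real.norm_of_nonneg measureReal_nonneg).trans_le measureReal_le_one
  have hΦi : Integrable Φ (stepLaw Q) :=
    Integrable.of_bound hΦm.aestronglyMeasurable 1 (Eventually.of_forall hΦb)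
  have hae : ∀ᵐ a ∂(stepLaw Q), 0 < a.1 :=
    (Measure.quasiMeasurePreserving_fst (μ := expMeasure 1)).ae ae_pos_expMeasure_one
  have h1 : aliveProb Q t i j = ∫ a, Φ a ∂(stepLaw Q) := by
    rw [aliveProb, Measure.real, ← map_consNoise Q, Measure.map_apply measurable_consNoise hS,
      Measure.prod_apply (measurable_consNoise hS), integral_eq_lintegral_of_nonneg_ae
        (Eventually.of_forall fun a => ?_) hΦm.aestronglyMeasurable]
    · congr 1
      refine lintegral_congr_ae ?_
      filter_upwards [hae] with a ha
      have : Prod.mk a ⁻¹' ((fun p : (ℝ × (Fin d → Fin d)) × Noise d => consNoise p.1 p.2) ⁻¹'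
          {ω | Alive Q i t ω ∧ chain Q i t ω = j}) = {ω | if -Q i i * t < a.1 then i = j else
            Alive Q (a.2 i) (t - a.1 / -Q i i) ω ∧ chain Q (a.2 i) (t - a.1 / -Q i i) ω = j} := by
        ext ω
        exact alive_and_chain_consNoise Q (hQ.neg_diag_nonneg i) ht ha a.2 ω j
      rw [this]
      simp only [hΦ]
      by_cases hlt : -Q i i * t < a.1
      · simp only [if_pos hlt]
        by_cases hij : i = j
        · simp only [if_pos hij, ENNReal.ofReal_one]
          simp [hij]
        · simp only [if_neg hij, ENNReal.ofReal_zero]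
          simp [hij]
      · simp only [if_neg hlt, aliveProb]
        exact (ofReal_measureReal).symm
    · simp only [hΦ]
      split_ifs
      · exact zero_le_one
      · exact le_rfl
      · exact measureReal_nonneg
  rw [h1, stepLaw, integral_prod _ hΦi]
  congr 1
  ext x
  simp only [hΦ]
  split_ifs
  · simp
  · simp
  · exact integral_jumpPMF Q i fun k => aliveProb Q (t - x / -Q i i) k j

end FirstStep

/-! ### Transition law of the chain -/

section TransitionLaw

variable {d : ℕ} {Q : Matrix (Fin d) (Fin d) ℝ}

/-- The no-jump terms of the two first-step equations cancel. What remains averages earlier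
discrepancies over the event of a jump before `t`, whose probability is at most `ρ`. -/
lemma IsRateMatrix.contraction_step (hQ : IsRateMatrix Q) (j : Fin d) {T ρ B : ℝ}
    (hρ : ∀ i, 1 - Real.exp (-(-Q i i * T)) ≤ ρ) (hB : 0 ≤ B)
    (h : ∀ i, ∀ t ∈ Icc 0 T, |aliveProb Q t i j - semigroup Q t i j| ≤ B)
    (i : Fin d) {t : ℝ} (ht : t ∈ Icc 0 T) :
    |aliveProb Q t i j - semigroup Q t i j| ≤ ρ * B := by
  have hqi := hQ.neg_diag_nonneg i
  have hc : 0 ≤ -Q i i * t := mul_nonneg hqi ht.1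
  have hcont : ∀ k, Continuous fun x : ℝ => semigroup Q (t - x / -Q i i) k j := fun k =>
    (continuous_semigroup Q k j).comp (by fun_prop)
  have hkey : ∀ x : ℝ, 0 < x → ¬ -Q i i * t < x → ∀ k,
      |aliveProb Q (t - x / -Q i i) k j - semigroup Q (t - x / -Q i i) k j| ≤ B := by
    intro x hx hxt k
    have hpos : 0 < -Q i i := by
      rcases hqi.eq_or_lt with h0 | h0
      · rw [← h0, zero_mul] at hxt; exact absurd hx hxt
      · exact h0
    refine h k _ ⟨?_, ?_⟩
    · rw [sub_nonneg, div_le_iff₀ hpos, mul_comm]; exact not_lt.1 hxt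
    · have : 0 ≤ x / -Q i i := by positivity
      linarith [ht.2]
  set f₁ : ℝ → ℝ := fun x => if -Q i i * t < x then (if i = j then 1 else 0) else
      ∑ k, (jumpPMF Q i k).toReal * aliveProb Q (t - x / -Q i i) k j with hf₁
  set f₂ : ℝ → ℝ := fun x => if -Q i i * t < x then (if i = j then 1 else 0) else
      ∑ k, (jumpPMF Q i k).toReal * semigroup Q (t - x / -Q i i) k j with hf₂
  have hmeas : ∀ φ : ℝ → Fin d → ℝ, (∀ k, Measurable fun x => φ x k) → Measurable fun x : ℝ =>
      if -Q i i * t < x then (if i = j then (1 : ℝ) else 0) else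
        ∑ k, (jumpPMF Q i k).toReal * φ x k := fun φ hφ =>
    Measurable.ite (measurableSet_lt measurable_const measurable_id) measurable_const
      (Finset.measurable_fun_sum _ fun k _ => (hφ k).const_mul _)
  have hm₁ : Measurable f₁ := hmeas _ fun k => (measurable_aliveProb Q k j).comp (by fun_prop)
  have hm₂ : Measurable f₂ := hmeas _ fun k => (hcont k).measurable
  have hbound : ∀ x, 0 < x → ‖f₁ x - f₂ x‖ ≤ if -Q i i * t < x then 0 else B := by
    intro x hx
    by_cases hxt : -Q i i * t < x
    · simp only [hf₁, hf₂, if_pos hxt, sub_self, norm_zero, le_refl]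
    · simp only [hf₁, hf₂, if_neg hxt]
      rw [← Finset.sum_sub_distrib]
      calc ‖∑ k, ((jumpPMF Q i k).toReal * aliveProb Q (t - x / -Q i i) k j
            - (jumpPMF Q i k).toReal * semigroup Q (t - x / -Q i i) k j)‖
          ≤ ∑ k, (jumpPMF Q i k).toReal * B := by
            refine norm_sum_le_of_le _ fun k _ => ?_
            rw [← mul_sub, norm_mul, Real.norm_of_nonneg ENNReal.toReal_nonneg]
            exact mul_le_mul_of_nonneg_left (hkey x hx hxt k) ENNReal.toReal_nonneg
        _ = B := by rw [← Finset.sum_mul, sum_jumpPMF, one_mul]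
  have hint : ∀ φ : ℝ → ℝ, Measurable φ → ∀ C : ℝ, (∀ x, 0 < x → ‖φ x‖ ≤ C) →
      Integrable φ (expMeasure 1) := fun φ hφ C hC =>
    Integrable.of_bound hφ.aestronglyMeasurable C (ae_pos_expMeasure_one.mono hC)
  have hone : ∀ x, 0 < x → ‖f₁ x‖ ≤ 1 := by
    intro x hx
    simp only [hf₁]
    split_ifs
    · simp
    · simp
    · calc ‖∑ k, (jumpPMF Q i k).toReal * aliveProb Q (t - x / -Q i i) k j‖
          ≤ ∑ k, (jumpPMF Q i k).toReal * 1 := by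
            refine norm_sum_le_of_le _ fun k _ => ?_
            rw [norm_mul, Real.norm_of_nonneg ENNReal.toReal_nonneg]
            exact mul_le_mul_of_nonneg_left
              ((Real.norm_of_nonneg measureReal_nonneg).trans_le measureReal_le_one)
              ENNReal.toReal_nonneg
        _ = 1 := by rw [← Finset.sum_mul, sum_jumpPMF, one_mul]
  have hi₁ : Integrable f₁ (expMeasure 1) := hint f₁ hm₁ 1 hone
  have hi₂ : Integrable f₂ (expMeasure 1) := by
    refine hint f₂ hm₂ (1 + B) fun x hx => ?_
    have h1 := hone x hx
    have h2 := (hbound x hx).trans (show _ ≤ B by split_ifs <;> simp [hB])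
    calc ‖f₂ x‖ = ‖f₁ x - (f₁ x - f₂ x)‖ := by rw [sub_sub_cancel]
      _ ≤ 1 + B := (norm_sub_le _ _).trans (add_le_add h1 h2)
  have hle : |aliveProb Q t i j - semigroup Q t i j| ≤
      ∫ x, (if -Q i i * t < x then 0 else B) ∂(expMeasure 1) := by
    rw [hQ.aliveProb_first_step ht.1, hQ.semigroup_first_step ht.1, ← integral_sub hi₁ hi₂]
    refine norm_integral_le_of_norm_le ?_ (ae_pos_expMeasure_one.mono hbound)
    refine hint _ (Measurable.ite (measurableSet_lt measurable_const measurable_id)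
      measurable_const measurable_const) B fun x _ => ?_
    split_ifs <;> simp [hB, abs_of_nonneg]
  refine hle.trans ?_
  rw [integral_expMeasure_one_ite hc 0 continuous_const, mul_zero, zero_add,
    intervalIntegral.integral_mul_const]
  refine mul_le_mul_of_nonneg_right ?_ hB
  have hderiv : ∀ x : ℝ, HasDerivAt (fun x => -Real.exp (-x)) (Real.exp (-x)) x := fun x =>
    ((hasDerivAt_id x).neg.exp).neg.congr_deriv (by simp)
  rw [intervalIntegral.integral_eq_sub_of_hasDerivAt (fun x _ => hderiv x)
    (Continuous.intervalIntegrable (by fun_prop) _ _)]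
  refine le_trans ?_ (hρ i)
  have : Real.exp (-(-Q i i * T)) ≤ Real.exp (-(-Q i i * t)) :=
    Real.exp_le_exp.2 (neg_le_neg (mul_le_mul_of_nonneg_left ht.2 hqi))
  rw [neg_zero, Real.exp_zero]
  linarith

lemma IsRateMatrix.aliveProb_eq_semigroup (hQ : IsRateMatrix Q) {t : ℝ} (ht : 0 ≤ t)
    (i j : Fin d) : aliveProb Q t i j = semigroup Q t i j := by
  -- The total exit rate dominates each individual one, giving a single contraction factor below one
  -- for all states.
  set ρ : ℝ := 1 - Real.exp (-((∑ i, -Q i i) * t)) with hρ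
  have hρi : ∀ i, 1 - Real.exp (-(-Q i i * t)) ≤ ρ := by
    intro i
    have h1 : -Q i i ≤ ∑ i, -Q i i :=
      Finset.single_le_sum (f := fun i => -Q i i) (fun k _ => hQ.neg_diag_nonneg k)
        (Finset.mem_univ i)
    have h2 : Real.exp (-((∑ i, -Q i i) * t)) ≤ Real.exp (-(-Q i i * t)) :=
      Real.exp_le_exp.2 (neg_le_neg (mul_le_mul_of_nonneg_right h1 ht))
    linarith
  have hρ0 : 0 ≤ ρ := le_trans (by
    rw [sub_nonneg, Real.exp_le_one_iff, neg_nonpos]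
    exact mul_nonneg (hQ.neg_diag_nonneg i) ht) (hρi i)
  have hρ1 : ρ < 1 := by rw [hρ]; linarith [Real.exp_pos (-((∑ i, -Q i i) * t))]
  obtain ⟨K, hK⟩ : ∃ K, ∀ i, ∀ s ∈ Icc 0 t, |aliveProb Q s i j - semigroup Q s i j| ≤ K := by
    have hb : ∀ i, ∃ K, ∀ s ∈ Icc 0 t, ‖semigroup Q s i j‖ ≤ K := fun i =>
      isCompact_Icc.exists_bound_of_continuousOn (continuous_semigroup Q i j).continuousOn
    choose K hK using hb
    refine ⟨1 + ∑ i, |K i|, fun i s hs => (abs_sub _ _).trans (add_le_add ?_ ?_)⟩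
    · exact (abs_of_nonneg measureReal_nonneg).trans_le measureReal_le_one
    · exact (hK i s hs).trans ((le_abs_self _).trans
        (Finset.single_le_sum (f := fun i => |K i|) (fun k _ => abs_nonneg _) (Finset.mem_univ i)))
  have hK0 : 0 ≤ K := (abs_nonneg _).trans (hK i t ⟨ht, le_rfl⟩)
  have hn : ∀ n : ℕ, ∀ i, ∀ s ∈ Icc 0 t,
      |aliveProb Q s i j - semigroup Q s i j| ≤ ρ ^ n * K := by
    intro n
    induction n with
    | zero => simpa using hK
    | succ n ih =>
      intro i s hs
      rw [pow_succ', mul_assoc]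
      exact hQ.contraction_step j hρi (by positivity) ih i hs
  have hlim : Tendsto (fun n : ℕ => ρ ^ n * K) atTop (𝓝 (0 * K)) :=
    (tendsto_pow_atTop_nhds_zero_of_lt_one hρ0 hρ1).mul_const K
  rw [zero_mul] at hlim
  have := ge_of_tendsto' hlim fun n => hn n i t ⟨ht, le_rfl⟩
  exact sub_eq_zero.1 (abs_nonpos_iff.1 this)

lemma IsRateMatrix.semigroup_nonneg (hQ : IsRateMatrix Q) {t : ℝ} (ht : 0 ≤ t) (i j : Fin d) :
    0 ≤ semigroup Q t i j := by
  rw [← hQ.aliveProb_eq_semigroup ht]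
  exact measureReal_nonneg

/-- The transition probabilities of the chain are the entries of the semigroup of `Q`. -/
theorem IsRateMatrix.measureReal_chain_eq (hQ : IsRateMatrix Q) {t : ℝ} (ht : 0 ≤ t)
    (i j : Fin d) : (noiseLaw Q).real {ω | chain Q i t ω = j} = semigroup Q t i j := by
  have hle : ∀ j, semigroup Q t i j ≤ (noiseLaw Q).real {ω | chain Q i t ω = j} := fun j => by
    rw [← hQ.aliveProb_eq_semigroup ht]
    exact measureReal_mono fun ω hω => hω.2
  have hmeas : Measurable fun ω => chain Q i t ω := (measurable_chain Q i).comp measurable_prodMk_left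
  have hsum : ∑ j, (noiseLaw Q).real {ω | chain Q i t ω = j} = 1 := by
    have := sum_measureReal_preimage_singleton (μ := noiseLaw Q) (Finset.univ : Finset (Fin d))
      (f := fun ω => chain Q i t ω) fun j _ => hmeas (measurableSet_singleton j)
    rw [Finset.coe_univ, preimage_univ, probReal_univ] at this
    exact this
  -- The non-exploded mass already sums to one, so no inequality is strict; explosion has
  -- probability zero.
  exact ((Finset.sum_eq_sum_iff_of_le fun j _ => hle j).1
    ((hQ.sum_semigroup t i).trans hsum.symm) j (Finset.mem_univ j)).symm

end TransitionLaw

/-! ### Regular data and averaged rewards -/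

section Regular

variable {d : ℕ} {U : Type*} [TopologicalSpace U] [CompactSpace U] [MeasurableSpace U]
  [OpensMeasurableSpace U]

/-- The regularity of rates and rewards that the existence proof uses; `b` is an integrable
majorant of the rewards. -/
structure IsRegular (q : U → Matrix (Fin d) (Fin d) ℝ) (f : ℝ → Fin d → U → ℝ) (b : ℝ → ℝ) :
    Prop where
  isRateMatrix : ∀ u, IsRateMatrix (q u)
  continuous_rate : ∀ i j, Continuous fun u => q u i j
  continuous_reward : ∀ t, 0 ≤ t → ∀ i, Continuous (f t i)
  continuousOn_reward : ∀ i u, ContinuousOn (fun t => f t i u) (Ici 0)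
  integrableOn_bound : IntegrableOn b (Ioi 0)
  abs_le_bound : ∀ t, 0 ≤ t → ∀ i u, |f t i u| ≤ b t
  exists_local_bound : ∀ T, ∃ C, ∀ t ∈ Icc 0 T, ∀ i u, |f t i u| ≤ C

lemma integrable_of_continuous {φ : U → ℝ} (hφ : Continuous φ) (μ : ProbabilityMeasure U) :
    Integrable φ (μ : Measure U) := by
  obtain ⟨C, hC⟩ := isCompact_univ.exists_bound_of_continuousOn hφ.continuousOn
  exact Integrable.of_bound hφ.aestronglyMeasurable C
    (Eventually.of_forall fun u => hC u (mem_univ u))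

namespace IsRegular

variable {q : U → Matrix (Fin d) (Fin d) ℝ} {f : ℝ → Fin d → U → ℝ} {b : ℝ → ℝ}

lemma isRateMatrix_controlledRate (h : IsRegular q f b) (π : RelaxedControl d U) :
    IsRateMatrix (controlledRate q π) := by
  constructor
  · exact fun i j hij => integral_nonneg fun u => (h.isRateMatrix u).1 i j hij
  · intro i
    simp only [controlledRate, relaxedRate, Matrix.of_apply]
    rw [← integral_finsetSum _ fun j _ => integrable_of_continuous (h.continuous_rate i j) (π i),
      ← integral_neg]
    exact integral_congr_ae (Eventually.of_forall fun u => (h.isRateMatrix u).2 i)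

omit [CompactSpace U] [OpensMeasurableSpace U] in
lemma abs_relaxedReward_le (h : IsRegular q f b) (μ : ProbabilityMeasure U) {t : ℝ} (ht : 0 ≤ t)
    (i : Fin d) : |relaxedReward f μ t i| ≤ b t := by
  have := norm_integral_le_of_norm_le_const (μ := (μ : Measure U)) (f := f t i) (C := b t)
    (Eventually.of_forall fun u => h.abs_le_bound t ht i u)
  simpa [relaxedReward] using this

omit [CompactSpace U] in
lemma continuousOn_relaxedReward (h : IsRegular q f b) (μ : ProbabilityMeasure U) (i : Fin d) :
    ContinuousOn (fun t => relaxedReward f μ t i) (Ici 0) := by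
  intro t ht
  -- The integrable majorant `b` need not be bounded near `t`, so domination over `U` uses a local
  -- constant.
  obtain ⟨C, hC⟩ := h.exists_local_bound (t + 1)
  have hev : ∀ᶠ s in 𝓝[Ici 0] t, s ∈ Icc 0 (t + 1) := by
    filter_upwards [self_mem_nhdsWithin,
      nhdsWithin_le_nhds (Iio_mem_nhds (lt_add_one t))] with s hs hs'
    exact ⟨hs, le_of_lt hs'⟩
  refine continuousWithinAt_of_dominated (bound := fun _ => C) ?_ ?_ (integrable_const _) ?_
  · exact hev.mono fun s hs => (h.continuous_reward s hs.1 i).aestronglyMeasurable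
  · exact hev.mono fun s hs => Eventually.of_forall fun u => hC s hs i u
  · exact Eventually.of_forall fun u => h.continuousOn_reward i u t ht

omit [CompactSpace U] in
lemma integrableOn_relaxedReward (h : IsRegular q f b) (μ : ProbabilityMeasure U) (i : Fin d) :
    IntegrableOn (fun t => relaxedReward f μ t i) (Ioi 0) :=
  h.integrableOn_bound.mono' (((h.continuousOn_relaxedReward μ i).mono
    Ioi_subset_Ici_self).aestronglyMeasurable measurableSet_Ioi)
    ((ae_restrict_mem measurableSet_Ioi).mono fun _ ht => h.abs_relaxedReward_le μ (le_of_lt ht) i)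

end IsRegular

end Regular

/-! ### Expected rewards through one-dimensional marginals -/

section ChainReward

/-- By Fubini, an additive reward depends on the process only through its law at each single time.
-/
lemma integral_process {d : ℕ} {Ω : Type*} [MeasurableSpace Ω] (μ : Measure Ω)
    [IsProbabilityMeasure μ] {Y : ℝ → Ω → Fin d} (hY : Measurable fun p : Ω × ℝ => Y p.2 p.1)
    {G : Fin d → ℝ → ℝ} (hG : ∀ j, IntegrableOn (G j) (Ioi 0)) :
    ∫ ω, (∫ s in Ioi (0 : ℝ), G (Y s ω) s) ∂μ
      = ∫ s in Ioi (0 : ℝ), ∑ j, μ.real {ω | Y s ω = j} * G j s := by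
  have hset : ∀ j, MeasurableSet {p : Ω × ℝ | Y p.2 p.1 = j} := fun j =>
    hY (measurableSet_singleton j)
  have hsum : ∀ (s : ℝ) (ω : Ω), G (Y s ω) s = ∑ j, {ω | Y s ω = j}.indicator (fun _ => G j s) ω := by
    intro s ω
    rw [Finset.sum_eq_single (Y s ω)]
    · exact (indicator_of_mem (s := {ω' | Y s ω' = Y s ω}) (f := fun _ => G (Y s ω) s) rfl).symm
    · exact fun j _ hj => indicator_of_notMem (s := {ω' | Y s ω' = j}) (f := fun _ => G j s)
        (fun h => hj h.symm)
    · simp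
  have hint : Integrable (fun p : Ω × ℝ => G (Y p.2 p.1) p.2)
      (μ.prod (volume.restrict (Ioi 0))) := by
    have : (fun p : Ω × ℝ => G (Y p.2 p.1) p.2)
        = fun p => ∑ j, {p : Ω × ℝ | Y p.2 p.1 = j}.indicator (fun p => G j p.2) p := by
      ext p
      exact hsum p.2 p.1
    rw [this]
    exact integrable_finsetSum _ fun j _ => ((hG j).comp_snd μ).indicator (hset j)
  rw [integral_integral_swap hint]
  congr 1
  ext s
  have hset' : ∀ j, MeasurableSet {ω : Ω | Y s ω = j} := fun j => measurable_prodMk_right (hset j)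
  simp_rw [hsum s]
  rw [integral_finsetSum _ fun j _ => (integrable_const _).indicator (hset' j)]
  refine Finset.sum_congr rfl fun j _ => ?_
  rw [integral_indicator (hset' j), setIntegral_const, smul_eq_mul]

end ChainReward

/-! ### Deterministic formulas for the values -/

section Values

variable {d : ℕ} {U : Type*} [TopologicalSpace U] [CompactSpace U] [MeasurableSpace U]
  [OpensMeasurableSpace U]
  {q : U → Matrix (Fin d) (Fin d) ℝ} {f : ℝ → Fin d → U → ℝ} {b : ℝ → ℝ}

/-- The expected reward rate at time `s` of the control `π` started `r` time units earlier. -/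
noncomputable def expectedReward (q : U → Matrix (Fin d) (Fin d) ℝ) (f : ℝ → Fin d → U → ℝ)
    (π : RelaxedControl d U) (k : Fin d) (r s : ℝ) : ℝ :=
  ∑ j, semigroup (controlledRate q π) r k j * relaxedReward f (π j) s j

lemma IsRegular.abs_expectedReward_le (h : IsRegular q f b) (π : RelaxedControl d U) (k : Fin d)
    {r s : ℝ} (hr : 0 ≤ r) (hs : 0 ≤ s) : |expectedReward q f π k r s| ≤ b s := by
  have hQ := h.isRateMatrix_controlledRate π
  calc |expectedReward q f π k r s|
      ≤ ∑ j, semigroup (controlledRate q π) r k j * b s := by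
        refine (Finset.abs_sum_le_sum_abs _ _).trans (Finset.sum_le_sum fun j _ => ?_)
        rw [abs_mul, abs_of_nonneg (hQ.semigroup_nonneg hr k j)]
        exact mul_le_mul_of_nonneg_left (h.abs_relaxedReward_le _ hs j)
          (hQ.semigroup_nonneg hr k j)
    _ = b s := by rw [← Finset.sum_mul, hQ.sum_semigroup, one_mul]

omit [CompactSpace U] in
lemma IsRegular.continuousOn_expectedReward (h : IsRegular q f b) (π : RelaxedControl d U)
    (k : Fin d) {ρ : ℝ → ℝ} (hρ : Continuous ρ) :
    ContinuousOn (fun s => expectedReward q f π k (ρ s) s) (Ici 0) :=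
  continuousOn_finsetSum _ fun j _ =>
    ((continuous_semigroup _ k j).comp hρ).continuousOn.mul (h.continuousOn_relaxedReward (π j) j)

omit [TopologicalSpace U] [CompactSpace U] [OpensMeasurableSpace U] in
lemma expectedReward_zero (π : RelaxedControl d U) (k : Fin d) (s : ℝ) :
    expectedReward q f π k 0 s = relaxedReward f (π k) s k := by
  simp [expectedReward, semigroup_zero]

-- Chapman–Kolmogorov in the age `r` of the chain, with the date `s` of the reward held fixed. The
-- two clocks are separate because after `ε` the restarted chain has age `s - ε` while rewards are
-- still dated `s`.
omit [TopologicalSpace U] [CompactSpace U] [OpensMeasurableSpace U] in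
lemma expectedReward_add (π : RelaxedControl d U) (k : Fin d) (r₁ r₂ s : ℝ) :
    expectedReward q f π k (r₁ + r₂) s
      = ∑ l, semigroup (controlledRate q π) r₁ k l * expectedReward q f π l r₂ s := by
  simp only [expectedReward, semigroup_add, Finset.sum_mul, Finset.mul_sum]
  rw [Finset.sum_comm]
  simp_rw [mul_assoc]

lemma IsRegular.value_eq (h : IsRegular q f b) (π : RelaxedControl d U) (i : Fin d) :
    value q f π i = ∫ s in Ioi (0 : ℝ), expectedReward q f π i s s := by
  rw [value, integral_process (noiseLaw (controlledRate q π))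
    (Y := fun s ω => chain (controlledRate q π) i s ω)
    (G := fun j s => relaxedReward f (π j) s j)
    ((measurable_chain _ i).comp measurable_swap) fun j => h.integrableOn_relaxedReward (π j) j]
  refine setIntegral_congr_fun measurableSet_Ioi fun s hs => ?_
  refine Finset.sum_congr rfl fun j _ => ?_
  rw [(h.isRateMatrix_controlledRate π).measureReal_chain_eq (le_of_lt hs)]

omit [TopologicalSpace U] [CompactSpace U] [OpensMeasurableSpace U] in
lemma measurable_concatChain (π' π : RelaxedControl d U) (ε : ℝ) (i : Fin d) :
    Measurable fun p : (Noise d × Noise d) × ℝ => concatChain q π' π ε i p.2 p.1 := by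
  have h1 : Measurable fun p : (ℝ × Noise d) × Fin d =>
      chain (controlledRate q π) p.2 p.1.1 p.1.2 :=
    measurable_from_prod_countable_left fun k => measurable_chain _ k
  have h2 : Measurable fun ω : Noise d => chain (controlledRate q π') i ε ω :=
    (measurable_chain _ i).comp measurable_prodMk_left
  unfold concatChain
  refine Measurable.ite (measurableSet_lt measurable_snd measurable_const) ?_ ?_
  · exact (measurable_chain _ i).comp
      (measurable_snd.prodMk (measurable_fst.comp measurable_fst))
  · exact h1.comp (((measurable_snd.sub_const ε).prodMk (measurable_snd.comp measurable_fst)).prodMk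
      (h2.comp (measurable_fst.comp measurable_fst)))

lemma IsRegular.measureReal_concatChain_of_lt (h : IsRegular q f b) (π' π : RelaxedControl d U)
    {ε s : ℝ} (hs : 0 ≤ s) (hsε : s < ε) (i j : Fin d) :
    ((noiseLaw (controlledRate q π')).prod (noiseLaw (controlledRate q π))).real
      {ω | concatChain q π' π ε i s ω = j} = semigroup (controlledRate q π') s i j := by
  have : {ω | concatChain q π' π ε i s ω = j}
      = {ω | chain (controlledRate q π') i s ω = j} ×ˢ (univ : Set (Noise d)) := by
    ext ω
    simp [concatChain, hsε]
  rw [this, measureReal_prod_prod, probReal_univ, mul_one,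
    (h.isRateMatrix_controlledRate π').measureReal_chain_eq hs]

lemma IsRegular.measureReal_concatChain_of_le (h : IsRegular q f b) (π' π : RelaxedControl d U)
    {ε s : ℝ} (hε : 0 ≤ ε) (hsε : ε ≤ s) (i j : Fin d) :
    ((noiseLaw (controlledRate q π')).prod (noiseLaw (controlledRate q π))).real
      {ω | concatChain q π' π ε i s ω = j}
      = ∑ k, semigroup (controlledRate q π') ε i k * semigroup (controlledRate q π) (s - ε) k j := by
  -- Splitting by the state at `ε` yields disjoint rectangles, on which the two independent noises
  -- factor.
  have : {ω | concatChain q π' π ε i s ω = j} = ⋃ k ∈ (Finset.univ : Finset (Fin d)),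
      {ω | chain (controlledRate q π') i ε ω = k} ×ˢ
        {ω | chain (controlledRate q π) k (s - ε) ω = j} := by
    ext ω
    simp [concatChain, not_lt.2 hsε]
  have hm : ∀ (R : Matrix (Fin d) (Fin d) ℝ) (i k : Fin d) (t : ℝ),
      MeasurableSet {ω | chain R i t ω = k} := fun R i k t =>
    ((measurable_chain R i).comp measurable_prodMk_left) (measurableSet_singleton k)
  rw [this, measureReal_biUnion_finset]
  · refine Finset.sum_congr rfl fun k _ => ?_
    rw [measureReal_prod_prod, (h.isRateMatrix_controlledRate π').measureReal_chain_eq hε,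
      (h.isRateMatrix_controlledRate π).measureReal_chain_eq (sub_nonneg.2 hsε)]
  · intro k _ l _ hkl
    refine Set.disjoint_left.2 fun ω hω hω' => hkl ?_
    exact hω.1.symm.trans hω'.1
  · exact fun k _ => (hm _ i k ε).prod (hm _ k j (s - ε))

lemma IsRegular.concatValue_eq (h : IsRegular q f b) (π' π : RelaxedControl d U) {ε : ℝ}
    (hε : 0 ≤ ε) (i : Fin d) :
    concatValue q f π' π ε i = ∫ s in Ioi (0 : ℝ), if s < ε then expectedReward q f π' i s s
      else ∑ k, semigroup (controlledRate q π') ε i k * expectedReward q f π k (s - ε) s := by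
  have hG : ∀ j, IntegrableOn
      (fun s => relaxedReward f ((if s < ε then π' else π) j) s j) (Ioi 0) := by
    intro j
    have : (fun s => relaxedReward f ((if s < ε then π' else π) j) s j)
        = (Iio ε).piecewise (fun s => relaxedReward f (π' j) s j)
          fun s => relaxedReward f (π j) s j := by
      ext s
      by_cases hs : s < ε <;> simp [hs]
    rw [this]
    exact Integrable.piecewise measurableSet_Iio
      (h.integrableOn_relaxedReward (π' j) j).integrableOn
      (h.integrableOn_relaxedReward (π j) j).integrableOn
  rw [concatValue, integral_process
    ((noiseLaw (controlledRate q π')).prod (noiseLaw (controlledRate q π)))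
    (Y := fun s ω => concatChain q π' π ε i s ω)
    (G := fun j s => relaxedReward f ((if s < ε then π' else π) j) s j)
    (measurable_concatChain π' π ε i) hG]
  refine setIntegral_congr_fun measurableSet_Ioi fun s hs => ?_
  have hs0 : 0 ≤ s := le_of_lt hs
  by_cases hsε : s < ε
  · simp only [if_pos hsε, expectedReward]
    exact Finset.sum_congr rfl fun j _ => by
      rw [h.measureReal_concatChain_of_lt π' π hs0 hsε]
  · simp only [if_neg hsε, expectedReward, Finset.mul_sum]
    rw [Finset.sum_comm]
    refine Finset.sum_congr rfl fun j _ => ?_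
    rw [h.measureReal_concatChain_of_le π' π hε (not_lt.1 hsε), Finset.sum_mul]
    simp_rw [mul_assoc]

end Values

/-! ### First variation of the value -/

section Derivative

variable {d : ℕ} {U : Type*} [TopologicalSpace U] [CompactSpace U] [MeasurableSpace U]
  [OpensMeasurableSpace U]
  {q : U → Matrix (Fin d) (Fin d) ℝ} {f : ℝ → Fin d → U → ℝ} {b : ℝ → ℝ}

/-- The Hamiltonian at state `i` of the distribution `μ` over actions when the continuation values
are `V`. -/
noncomputable def hamiltonian (q : U → Matrix (Fin d) (Fin d) ℝ) (f : ℝ → Fin d → U → ℝ)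
    (V : Fin d → ℝ) (i : Fin d) (μ : ProbabilityMeasure U) : ℝ :=
  relaxedReward f μ 0 i + ∑ k, relaxedRate q μ i k * V k

/-- The age `s - ε` tends to `s`, the semigroup is continuous in time, and `b` dominates. -/
lemma IsRegular.tendsto_tail (h : IsRegular q f b) (π : RelaxedControl d U) (k : Fin d) :
    Tendsto (fun ε : ℝ => ∫ s in Ioi (0 : ℝ), if s < ε then 0 else expectedReward q f π k (s - ε) s)
      (𝓝[>] 0) (𝓝 (value q f π k)) := by
  rw [h.value_eq]
  refine tendsto_integral_filter_of_dominated_convergence b ?_ ?_ h.integrableOn_bound ?_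
  · refine Eventually.of_forall fun ε => ?_
    have hm : AEStronglyMeasurable (fun s => expectedReward q f π k (s - ε) s)
        (volume.restrict (Ioi 0)) :=
      ((h.continuousOn_expectedReward π k (by fun_prop)).mono
        Ioi_subset_Ici_self).aestronglyMeasurable measurableSet_Ioi
    have : (fun s => if s < ε then 0 else expectedReward q f π k (s - ε) s)
        = (Ici ε).indicator fun s => expectedReward q f π k (s - ε) s := by
      ext s
      by_cases hs : s < ε
      · rw [if_pos hs, indicator_of_notMem (by simpa using hs)]
      · rw [if_neg hs, indicator_of_mem (by simpa using hs)]
    rw [this]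
    exact hm.indicator measurableSet_Ici
  · refine Eventually.of_forall fun ε => (ae_restrict_mem measurableSet_Ioi).mono fun s hs => ?_
    have hs0 : 0 ≤ s := le_of_lt hs
    split_ifs with hsε
    · rw [norm_zero]
      exact (abs_nonneg _).trans (h.abs_expectedReward_le π k hs0 hs0)
    · exact h.abs_expectedReward_le π k (sub_nonneg.2 (not_lt.1 hsε)) hs0
  · refine (ae_restrict_mem measurableSet_Ioi).mono fun s hs => ?_
    have hcont : Continuous fun ε => expectedReward q f π k (s - ε) s :=
      continuous_finsetSum _ fun j _ =>
        ((continuous_semigroup _ k j).comp (continuous_const.sub continuous_id)).mul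
          continuous_const
    have h1 : Tendsto (fun ε => expectedReward q f π k (s - ε) s) (𝓝[>] 0)
        (𝓝 (expectedReward q f π k s s)) := by
      have := hcont.tendsto 0
      simp only [sub_zero] at this
      exact this.mono_left nhdsWithin_le_nhds
    refine h1.congr' ?_
    filter_upwards [nhdsWithin_le_nhds (Iio_mem_nhds (mem_Ioi.1 hs))] with ε hε
    rw [if_neg (not_lt.2 (le_of_lt hε))]

lemma IsRegular.integrableOn_expectedReward (h : IsRegular q f b) (π : RelaxedControl d U)
    (k : Fin d) {ρ : ℝ → ℝ} (hρ : Continuous ρ) {S : Set ℝ} (hS : MeasurableSet S)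
    (hS0 : S ⊆ Ioi 0) (hρ0 : ∀ s ∈ S, 0 ≤ ρ s) :
    IntegrableOn (fun s => expectedReward q f π k (ρ s) s) S :=
  (h.integrableOn_bound.mono_set hS0).mono' (((h.continuousOn_expectedReward π k hρ).mono
    (hS0.trans Ioi_subset_Ici_self)).aestronglyMeasurable hS)
    ((ae_restrict_mem hS).mono fun s hs =>
      h.abs_expectedReward_le π k (hρ0 s hs) (le_of_lt (hS0 hs)))

lemma IsRegular.concatValue_sub_value (h : IsRegular q f b) (π' π : RelaxedControl d U) {ε : ℝ}
    (hε : 0 < ε) (i : Fin d) :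
    concatValue q f π' π ε i - value q f π i
      = (∫ s in (0 : ℝ)..ε, (expectedReward q f π' i s s - expectedReward q f π i s s))
        + ∑ k, (semigroup (controlledRate q π') ε i k - semigroup (controlledRate q π) ε i k)
          * ∫ s in Ioi (0 : ℝ), if s < ε then 0 else expectedReward q f π k (s - ε) s := by
  have hsplit : Ioi (0 : ℝ) = Ioo 0 ε ∪ Ici ε := (Ioo_union_Ici_eq_Ioi hε).symm
  have hdisj : Disjoint (Ioo (0 : ℝ) ε) (Ici ε) :=
    Set.disjoint_left.2 fun s hs hs' => absurd hs.2 (not_lt.2 hs')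
  have hIci : Ici ε ⊆ Ioi 0 := fun s hs => hε.trans_le hs
  have hint1 : ∀ π : RelaxedControl d U, IntegrableOn (fun s => expectedReward q f π i s s)
      (Ioo 0 ε) := fun π => h.integrableOn_expectedReward π i continuous_id measurableSet_Ioo
        Ioo_subset_Ioi_self fun s hs => hs.1.le
  have hint2 : ∀ k, IntegrableOn (fun s => expectedReward q f π k (s - ε) s) (Ici ε) := fun k =>
    h.integrableOn_expectedReward π k (continuous_id.sub continuous_const) measurableSet_Ici
      hIci fun s hs => sub_nonneg.2 hs
  have hint3 : ∀ a : Fin d → ℝ,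
      IntegrableOn (fun s => ∑ k, a k * expectedReward q f π k (s - ε) s) (Ici ε) := fun a =>
    integrable_finsetSum _ fun k _ => (hint2 k).const_mul (a k)
  have key : ∀ (π' : RelaxedControl d U), (∫ s in Ioi (0 : ℝ), if s < ε then
        expectedReward q f π' i s s else
          ∑ k, semigroup (controlledRate q π') ε i k * expectedReward q f π k (s - ε) s)
      = (∫ s in Ioo 0 ε, expectedReward q f π' i s s)
        + ∑ k, semigroup (controlledRate q π') ε i k
          * ∫ s in Ici ε, expectedReward q f π k (s - ε) s := by
    intro π'
    have e1 : EqOn (fun s => if s < ε then expectedReward q f π' i s s else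
        ∑ k, semigroup (controlledRate q π') ε i k * expectedReward q f π k (s - ε) s)
        (fun s => expectedReward q f π' i s s) (Ioo 0 ε) := fun s hs => if_pos hs.2
    have e2 : EqOn (fun s => if s < ε then expectedReward q f π' i s s else
        ∑ k, semigroup (controlledRate q π') ε i k * expectedReward q f π k (s - ε) s)
        (fun s => ∑ k, semigroup (controlledRate q π') ε i k * expectedReward q f π k (s - ε) s)
        (Ici ε) := fun s hs => if_neg (not_lt.2 hs)
    rw [hsplit, setIntegral_union hdisj measurableSet_Ici
      ((hint1 π').congr_fun e1.symm measurableSet_Ioo)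
      ((hint3 _).congr_fun e2.symm measurableSet_Ici),
      setIntegral_congr_fun measurableSet_Ioo e1, setIntegral_congr_fun measurableSet_Ici e2,
      integral_finsetSum _ fun k _ => (hint2 k).const_mul _]
    simp_rw [integral_const_mul]
  have htail : ∀ k, (∫ s in Ioi (0 : ℝ), if s < ε then 0 else expectedReward q f π k (s - ε) s)
      = ∫ s in Ici ε, expectedReward q f π k (s - ε) s := by
    intro k
    have e1 : EqOn (fun s => if s < ε then 0 else expectedReward q f π k (s - ε) s)
        (fun _ => 0) (Ioo 0 ε) := fun s hs => if_pos hs.2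
    have e2 : EqOn (fun s => if s < ε then 0 else expectedReward q f π k (s - ε) s)
        (fun s => expectedReward q f π k (s - ε) s) (Ici ε) := fun s hs => if_neg (not_lt.2 hs)
    rw [hsplit, setIntegral_union hdisj measurableSet_Ici
      (integrableOn_zero.congr_fun e1.symm measurableSet_Ioo)
      ((hint2 k).congr_fun e2.symm measurableSet_Ici),
      setIntegral_congr_fun measurableSet_Ioo e1, setIntegral_congr_fun measurableSet_Ici e2,
      integral_zero, zero_add]
  -- By Chapman–Kolmogorov `π` is its own concatenation at `ε`, so both values share the same tail
  -- integrals and only their weights differ.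
  have hvalue : value q f π i = ∫ s in Ioi (0 : ℝ), if s < ε then
        expectedReward q f π i s s else
          ∑ k, semigroup (controlledRate q π) ε i k * expectedReward q f π k (s - ε) s := by
    rw [h.value_eq]
    congr 1
    ext s
    split_ifs
    · rfl
    · rw [← expectedReward_add, add_sub_cancel]
  rw [h.concatValue_eq π' π hε.le, hvalue, key, key, intervalIntegral.integral_of_le hε.le,
    integral_Ioc_eq_integral_Ioo, integral_sub (hint1 π') (hint1 π)]
  simp_rw [htail, sub_mul, Finset.sum_sub_distrib]
  ring

/-- The initial integral has slope the difference of rewards at time `0`. The weights of the tails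
have slope the difference of rates, and the tails converge to the value of `π`. -/
lemma IsRegular.tendsto_concatValue_sub_div (h : IsRegular q f b) (π' π : RelaxedControl d U)
    (i : Fin d) :
    Tendsto (fun ε : ℝ => (concatValue q f π' π ε i - value q f π i) / ε) (𝓝[>] 0)
      (𝓝 (hamiltonian q f (value q f π) i (π' i) - hamiltonian q f (value q f π) i (π i))) := by
  have h1 : Tendsto (fun ε : ℝ =>
      (∫ s in (0 : ℝ)..ε, (expectedReward q f π' i s s - expectedReward q f π i s s)) / ε)
      (𝓝[>] 0) (𝓝 (relaxedReward f (π' i) 0 i - relaxedReward f (π i) 0 i)) := by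
    set A : ℝ → ℝ := fun s => expectedReward q f π' i s s - expectedReward q f π i s s with hA
    have hAc : ContinuousOn A (Ici 0) := (h.continuousOn_expectedReward π' i continuous_id).sub
      (h.continuousOn_expectedReward π i continuous_id)
    have hA0 : A 0 = relaxedReward f (π' i) 0 i - relaxedReward f (π i) 0 i := by
      simp only [hA, expectedReward_zero]
    have hd : HasDerivWithinAt (fun ε => ∫ s in (0 : ℝ)..ε, A s) (A 0) (Ici 0) 0 := by
      refine intervalIntegral.integral_hasDerivWithinAt_right (t := Ioi 0)
        IntervalIntegrable.refl ?_ ?_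
      · exact ⟨Ioi 0, self_mem_nhdsWithin,
          (hAc.mono Ioi_subset_Ici_self).aestronglyMeasurable measurableSet_Ioi⟩
      · exact (hAc 0 self_mem_Ici).mono Ioi_subset_Ici_self
    have hd' := (hasDerivWithinAt_iff_tendsto_slope' (by simp)).1 hd.Ioi_of_Ici
    rw [← hA0]
    refine hd'.congr fun ε => ?_
    simp [slope_def_field]
  have h2 : ∀ k, Tendsto (fun ε : ℝ => (semigroup (controlledRate q π') ε i k
      - semigroup (controlledRate q π) ε i k) / ε) (𝓝[>] 0)
      (𝓝 (relaxedRate q (π' i) i k - relaxedRate q (π i) i k)) := by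
    intro k
    have hd : ∀ π : RelaxedControl d U, Tendsto (fun ε : ℝ =>
        (semigroup (controlledRate q π) ε i k - semigroup (controlledRate q π) 0 i k) / ε) (𝓝[>] 0)
        (𝓝 (relaxedRate q (π i) i k)) := by
      intro π
      have h0 := (hasDerivAt_semigroup (controlledRate q π) 0 i k).hasDerivWithinAt (s := Ioi 0)
      have h3 := (hasDerivWithinAt_iff_tendsto_slope' (by simp)).1 h0
      have h4 : ∑ l, controlledRate q π i l * semigroup (controlledRate q π) 0 l k
          = relaxedRate q (π i) i k := by
        simp [semigroup_zero, controlledRate]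
      rw [h4] at h3
      refine h3.congr fun ε => ?_
      simp [slope_def_field]
    refine ((hd π').sub (hd π)).congr fun ε => ?_
    rw [semigroup_zero, semigroup_zero, ← sub_div, sub_sub_sub_cancel_right]
  have h3 := h1.add (tendsto_finsetSum Finset.univ fun k _ => (h2 k).mul (h.tendsto_tail π k))
  have hlim : hamiltonian q f (value q f π) i (π' i) - hamiltonian q f (value q f π) i (π i)
      = (relaxedReward f (π' i) 0 i - relaxedReward f (π i) 0 i)
        + ∑ k, (relaxedRate q (π' i) i k - relaxedRate q (π i) i k) * value q f π k := by
    simp_rw [hamiltonian, sub_mul, Finset.sum_sub_distrib]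
    ring
  rw [hlim]
  refine h3.congr' ?_
  filter_upwards [self_mem_nhdsWithin] with ε hε
  rw [h.concatValue_sub_value π' π hε, add_div, Finset.sum_div]
  congr 1
  exact Finset.sum_congr rfl fun k _ => by ring

/-- A control whose action distributions maximize the Hamiltonian of its own value is a relaxed
equilibrium. -/
lemma IsRegular.isRelaxedEquilibrium (h : IsRegular q f b) {π : RelaxedControl d U}
    (hπ : ∀ i (μ : ProbabilityMeasure U),
      hamiltonian q f (value q f π) i μ ≤ hamiltonian q f (value q f π) i (π i)) :
    IsRelaxedEquilibrium q f π := by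
  intro π' i
  have hlim := (continuous_coe_real_ereal.tendsto _).comp (h.tendsto_concatValue_sub_div π' π i)
  have := hlim.limsup_eq
  simp only [Function.comp_def] at this
  rw [this]
  exact_mod_cast sub_nonpos.2 (hπ i (π' i))

end Derivative

/-! ### Existence by approximation and compactness -/

section Existence

variable {d : ℕ} {U : Type*} [TopologicalSpace U] [TopologicalSpace.MetrizableSpace U]
  [SecondCountableTopology U] [CompactSpace U] [MeasurableSpace U] [BorelSpace U]
  {q : U → Matrix (Fin d) (Fin d) ℝ} {f : ℝ → Fin d → U → ℝ} {b : ℝ → ℝ}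

omit [TopologicalSpace.MetrizableSpace U] [SecondCountableTopology U] in
lemma continuous_integral_probabilityMeasure {φ : U → ℝ} (hφ : Continuous φ) :
    Continuous fun μ : ProbabilityMeasure U => ∫ u, φ u ∂(μ : Measure U) :=
  continuous_iff_continuousAt.2 fun _ =>
    ProbabilityMeasure.tendsto_iff_forall_integral_tendsto.1 tendsto_id
      (BoundedContinuousFunction.mkOfCompact ⟨φ, hφ⟩)

/-- Weak convergence of the action distributions passes to averaged rates and rewards, then to the
semigroup at each time, and to the integral by domination. -/
lemma IsRegular.continuous_value (h : IsRegular q f b) (i : Fin d) :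
    Continuous fun π : RelaxedControl d U => value q f π i := by
  simp_rw [h.value_eq]
  refine continuous_of_dominated (bound := b) (fun π => ?_) (fun π => ?_) h.integrableOn_bound ?_
  · exact (h.integrableOn_expectedReward π i continuous_id measurableSet_Ioi subset_rfl
      fun s hs => le_of_lt hs).aestronglyMeasurable
  · exact (ae_restrict_mem measurableSet_Ioi).mono fun s hs =>
      h.abs_expectedReward_le π i (le_of_lt hs) (le_of_lt hs)
  · refine (ae_restrict_mem measurableSet_Ioi).mono fun s hs => ?_
    refine continuous_finsetSum _ fun j _ => Continuous.mul ?_ ?_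
    · exact continuous_semigroup_generator (fun k l =>
        (continuous_integral_probabilityMeasure (h.continuous_rate k l)).comp
          (continuous_apply k)) s i j
    · exact (continuous_integral_probabilityMeasure (h.continuous_reward s (le_of_lt hs) j)).comp
        (continuous_apply j)

omit [TopologicalSpace.MetrizableSpace U] [SecondCountableTopology U] in
lemma IsRegular.abs_value_le (h : IsRegular q f b) (π : RelaxedControl d U) (i : Fin d) :
    |value q f π i| ≤ ∫ s in Ioi (0 : ℝ), b s := by
  rw [h.value_eq]
  exact norm_integral_le_of_norm_le (f := fun s => expectedReward q f π i s s)
    h.integrableOn_bound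
    ((ae_restrict_mem measurableSet_Ioi).mono fun s hs =>
      h.abs_expectedReward_le π i (le_of_lt hs) (le_of_lt hs))

/-- The Hamiltonian of a single action. -/
noncomputable def pointHamiltonian (q : U → Matrix (Fin d) (Fin d) ℝ) (f : ℝ → Fin d → U → ℝ)
    (V : Fin d → ℝ) (i : Fin d) (u : U) : ℝ :=
  f 0 i u + ∑ k, q u i k * V k

omit [TopologicalSpace.MetrizableSpace U] [SecondCountableTopology U] [CompactSpace U]
  [MeasurableSpace U] [BorelSpace U] in
lemma IsRegular.continuous_pointHamiltonian (h : IsRegular q f b) (V : Fin d → ℝ) (i : Fin d) :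
    Continuous (pointHamiltonian q f V i) :=
  (h.continuous_reward 0 le_rfl i).add
    (continuous_finsetSum _ fun k _ => (h.continuous_rate i k).mul continuous_const)

omit [TopologicalSpace.MetrizableSpace U] [SecondCountableTopology U] in
lemma IsRegular.hamiltonian_eq (h : IsRegular q f b) (V : Fin d → ℝ) (i : Fin d)
    (μ : ProbabilityMeasure U) :
    hamiltonian q f V i μ = ∫ u, pointHamiltonian q f V i u ∂(μ : Measure U) := by
  have hq : ∀ k, Integrable (fun u => q u i k * V k) (μ : Measure U) := fun k =>
    (integrable_of_continuous (h.continuous_rate i k) μ).mul_const _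
  simp only [pointHamiltonian]
  rw [integral_add (integrable_of_continuous (h.continuous_reward 0 le_rfl i) μ)
    (integrable_finsetSum _ fun k _ => hq k), integral_finsetSum _ fun k _ => hq k]
  simp_rw [integral_mul_const]
  rfl

omit [TopologicalSpace.MetrizableSpace U] [SecondCountableTopology U] in
/-- Distributions on finitely many points that depend continuously on the scores of these points
and almost maximize the mean score. -/
lemma exists_continuous_almost_maximizer {ι : Type*} [Fintype ι] [Nonempty ι] (x : ι → U) {δ : ℝ}
    (hδ : 0 < δ) : ∃ m : (ι → ℝ) → ProbabilityMeasure U, Continuous m ∧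
      ∀ φ : U → ℝ, Continuous φ → ∀ k, φ (x k) - δ ≤ ∫ u, φ u ∂(m (φ ∘ x) : Measure U) := by
  set top : (ι → ℝ) → ℝ := fun c => Finset.univ.sup' Finset.univ_nonempty c with htop
  -- Only points scoring within `δ` of the top get positive weight, and a best point gets weight
  -- `δ`, so normalization is possible.
  set w : (ι → ℝ) → ι → ℝ := fun c k => max 0 (c k - top c + δ) with hw
  have htopc : Continuous top :=
    Continuous.finset_sup'_apply Finset.univ_nonempty fun k _ => continuous_apply k
  have hwc : ∀ k, Continuous fun c => w c k := fun k =>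
    continuous_const.max (((continuous_apply k).sub htopc).add continuous_const)
  have hw0 : ∀ c k, 0 ≤ w c k := fun c k => le_max_left _ _
  have hwpos : ∀ c, 0 < ∑ k, w c k := by
    intro c
    obtain ⟨k, -, hk⟩ := Finset.exists_mem_eq_sup' Finset.univ_nonempty c
    refine Finset.sum_pos' (fun k _ => hw0 c k) ⟨k, Finset.mem_univ k, lt_max_of_lt_right ?_⟩
    simp only [htop, hk, sub_self, zero_add, hδ]
  set p : (ι → ℝ) → ι → ℝ := fun c k => w c k / ∑ l, w c l with hp
  have hp0 : ∀ c k, 0 ≤ p c k := fun c k => div_nonneg (hw0 c k) (hwpos c).le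
  have hp1 : ∀ c, ∑ k, p c k = 1 := fun c => by
    simp only [hp]
    rw [← Finset.sum_div, div_self (hwpos c).ne']
  have hpc : ∀ k, Continuous fun c => p c k := fun k =>
    (hwc k).div (continuous_finsetSum _ fun l _ => hwc l) fun c => (hwpos c).ne'
  let m : (ι → ℝ) → ProbabilityMeasure U := fun c =>
    ⟨∑ k, ENNReal.ofReal (p c k) • Measure.dirac (x k), ⟨by
      simp only [Measure.coe_finsetSum, Measure.coe_smul, Finset.sum_apply, Pi.smul_apply,
        measure_univ, smul_eq_mul, mul_one]
      rw [← ENNReal.ofReal_sum_of_nonneg fun k _ => hp0 c k, hp1, ENNReal.ofReal_one]⟩⟩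
  have hm : ∀ c (φ : U → ℝ), Continuous φ →
      ∫ u, φ u ∂(m c : Measure U) = ∑ k, p c k * φ (x k) := by
    intro c φ hφ
    have hi : ∀ k, Integrable φ (ENNReal.ofReal (p c k) • Measure.dirac (x k)) := fun k =>
      (integrable_of_continuous hφ ⟨Measure.dirac (x k), inferInstance⟩).smul_measure
        ENNReal.ofReal_ne_top
    have : (m c : Measure U) = ∑ k, ENNReal.ofReal (p c k) • Measure.dirac (x k) := rfl
    rw [this, integral_finsetSum_measure fun k _ => hi k]
    refine Finset.sum_congr rfl fun k _ => ?_
    rw [integral_smul_measure, integral_dirac' _ _ hφ.stronglyMeasurable,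
      ENNReal.toReal_ofReal (hp0 c k), smul_eq_mul]
  refine ⟨m, ?_, fun φ hφ k => ?_⟩
  · refine continuous_iff_continuousAt.2 fun c => ?_
    refine ProbabilityMeasure.tendsto_iff_forall_integral_tendsto.2 fun φ => ?_
    simp_rw [hm _ φ φ.continuous]
    exact tendsto_finsetSum _ fun k _ => ((hpc k).tendsto c).mul_const _
  · rw [hm _ φ hφ]
    set c := φ ∘ x with hc
    have hle : φ (x k) ≤ top c := Finset.le_sup' c (Finset.mem_univ k)
    calc φ (x k) - δ ≤ top c - δ := by linarith
      _ = ∑ l, p c l * (top c - δ) := by rw [← Finset.sum_mul, hp1, one_mul]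
      _ ≤ ∑ l, p c l * φ (x l) := by
        refine Finset.sum_le_sum fun l _ => ?_
        rcases (hp0 c l).eq_or_lt with h0 | hpos
        · rw [← h0, zero_mul, zero_mul]
        · refine mul_le_mul_of_nonneg_left ?_ hpos.le
          by_contra! hcon
          have : w c l = 0 := max_eq_left (by simp only [hc, Function.comp] at hcon ⊢; linarith)
          simp [hp, this] at hpos

theorem IsRegular.exists_isRelaxedEquilibrium [Nonempty U] (h : IsRegular q f b) :
    ∃ π : RelaxedControl d U, IsRelaxedEquilibrium q f π := by
  rcases isEmpty_or_nonempty (Fin d) with hd | hd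
  · exact ⟨fun i => hd.elim i, fun _ i => hd.elim i⟩
  set x : ℕ → U := TopologicalSpace.denseSeq U
  have happrox : ∀ n : ℕ, ∃ π : RelaxedControl d U, ∀ i, ∀ k ≤ n,
      pointHamiltonian q f (value q f π) i (x k) - 1 / ((n : ℝ) + 1)
        ≤ hamiltonian q f (value q f π) i (π i) := by
    intro n
    obtain ⟨m, hmc, hm⟩ := exists_continuous_almost_maximizer (fun k : Fin (n + 1) => x k)
      (Nat.one_div_pos_of_nat (α := ℝ) (n := n))
    let P : (Fin d → ℝ) → RelaxedControl d U := fun V i =>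
      m (pointHamiltonian q f V i ∘ fun k : Fin (n + 1) => x k)
    have hP : Continuous P := continuous_pi fun i => hmc.comp <| continuous_pi fun k => by
      simp only [Function.comp, pointHamiltonian]
      fun_prop
    -- The fixed point is sought among continuation values, in `ℝ^d`, rather than among controls.
    obtain ⟨V, hV⟩ := exists_fixed_point_of_abs_le (F := fun V i => value q f (P V) i)
      (continuous_pi fun i => (h.continuous_value i).comp hP) fun V i => h.abs_value_le (P V) i
    have hV' : value q f (P V) = V := hV
    refine ⟨P V, fun i k hk => ?_⟩
    rw [hV', h.hamiltonian_eq]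
    exact hm _ (h.continuous_pointHamiltonian V i) ⟨k, Nat.lt_succ_of_le hk⟩
  choose π hπ using happrox
  obtain ⟨a, -, φ, hφ, hlim⟩ := (isCompact_univ (X := RelaxedControl d U)).tendsto_subseq
    fun n => mem_univ (π n)
  have hVlim : ∀ k, Tendsto (fun n => value q f (π (φ n)) k) atTop (𝓝 (value q f a k)) := fun k =>
    ((h.continuous_value k).tendsto a).comp hlim
  have hmax : ∀ i u, pointHamiltonian q f (value q f a) i u
      ≤ hamiltonian q f (value q f a) i (a i) := by
    intro i u
    refine (TopologicalSpace.denseRange_denseSeq U).induction_on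
      (p := fun u => pointHamiltonian q f (value q f a) i u ≤
        hamiltonian q f (value q f a) i (a i)) u
      -- By density only `u = x k` matters, and it competes at every level `φ n ≥ n ≥ k`.
      (isClosed_le (h.continuous_pointHamiltonian _ i) continuous_const) fun k => ?_
    have hl : Tendsto (fun n => pointHamiltonian q f (value q f (π (φ n))) i (x k)
        - 1 / ((φ n : ℝ) + 1)) atTop (𝓝 (pointHamiltonian q f (value q f a) i (x k) - 0)) :=
      (tendsto_const_nhds.add (tendsto_finsetSum _ fun l _ => (hVlim l).const_mul _)).sub
        ((tendsto_one_div_add_atTop_nhds_zero_nat (𝕜 := ℝ)).comp hφ.tendsto_atTop)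
    rw [sub_zero] at hl
    have hai : Tendsto (fun n => π (φ n) i) atTop (𝓝 (a i)) := (tendsto_pi_nhds.1 hlim) i
    have hr : Tendsto (fun n => hamiltonian q f (value q f (π (φ n))) i (π (φ n) i)) atTop
        (𝓝 (hamiltonian q f (value q f a) i (a i))) :=
      (((continuous_integral_probabilityMeasure
          (h.continuous_reward 0 le_rfl i)).tendsto _).comp hai).add
        (tendsto_finsetSum _ fun l _ => (((continuous_integral_probabilityMeasure
          (h.continuous_rate i l)).tendsto _).comp hai).mul (hVlim l))
    refine le_of_tendsto_of_tendsto hl hr ?_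
    filter_upwards [eventually_ge_atTop k] with n hn
    exact hπ (φ n) i k (hn.trans (hφ.id_le n))
  refine ⟨a, h.isRelaxedEquilibrium fun i μ => ?_⟩
  rw [h.hamiltonian_eq _ i μ]
  calc ∫ u, pointHamiltonian q f (value q f a) i u ∂(μ : Measure U)
      ≤ ∫ _u, hamiltonian q f (value q f a) i (a i) ∂(μ : Measure U) :=
        integral_mono (integrable_of_continuous (h.continuous_pointHamiltonian _ i) μ)
          (integrable_const _) (hmax i)
    _ = hamiltonian q f (value q f a) i (a i) := by simp

end Existence

/-! ### Regularity from the Lipschitz hypotheses -/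

section Lipschitz

/-- On compact `U` the uniform Lipschitz bound compares `f t i u` with `f t i u₀`, up to a constant
independent of `t`. The supremum is therefore finite at every time, and local bounds come from
continuity in `t` at `u₀`. -/
lemma isRegular_of_lipschitz {d ℓ : ℕ} {U : Set (EuclideanSpace ℝ (Fin ℓ))} (hU : IsCompact U)
    (hne : U.Nonempty) {q : U → Matrix (Fin d) (Fin d) ℝ} (hq : ∀ u, IsRateMatrix (q u))
    {f : ℝ → Fin d → U → ℝ} (hf_cont : ∀ i u, ContinuousOn (fun t => f t i u) (Ici 0))
    (hf_int : ∫⁻ t in Ici (0 : ℝ), ⨆ i, ⨆ u, ‖f t i u‖ₑ < ∞) {Θ : ℝ}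
    (h_lip : ∀ t : ℝ, 0 ≤ t → ∀ (i : Fin d) (u₁ u₂ : U),
      |f t i u₁ - f t i u₂| + ‖WithLp.toLp 2 (q u₁ i - q u₂ i)‖
        ≤ Θ * ‖(u₁ : EuclideanSpace ℝ (Fin ℓ)) - u₂‖) :
    IsRegular q f fun t => (⨆ i, ⨆ u, ‖f t i u‖ₑ).toReal := by
  have : CompactSpace U := isCompact_iff_compactSpace.1 hU
  have : Nonempty U := hne.to_subtype
  have hlipf : ∀ t, 0 ≤ t → ∀ i (u₁ u₂ : U), |f t i u₁ - f t i u₂| ≤ |Θ| * dist u₁ u₂ := by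
    intro t ht i u₁ u₂
    rw [Subtype.dist_eq, dist_eq_norm]
    have h1 := h_lip t ht i u₁ u₂
    have h2 := mul_le_mul_of_nonneg_right (le_abs_self Θ)
      (norm_nonneg ((u₁ : EuclideanSpace ℝ (Fin ℓ)) - u₂))
    linarith [norm_nonneg (WithLp.toLp 2 (q u₁ i - q u₂ i))]
  have hlipq : ∀ i k (u₁ u₂ : U), |q u₁ i k - q u₂ i k| ≤ |Θ| * dist u₁ u₂ := by
    intro i k u₁ u₂
    rw [Subtype.dist_eq, dist_eq_norm]
    have h1 := h_lip 0 le_rfl i u₁ u₂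
    have h2 := mul_le_mul_of_nonneg_right (le_abs_self Θ)
      (norm_nonneg ((u₁ : EuclideanSpace ℝ (Fin ℓ)) - u₂))
    have h3 := PiLp.norm_apply_le (WithLp.toLp 2 (q u₁ i - q u₂ i)) k
    simp only [Real.norm_eq_abs, Pi.sub_apply] at h3
    linarith [abs_nonneg (f 0 i u₁ - f 0 i u₂)]
  have hcont : ∀ φ : U → ℝ, (∀ u₁ u₂, |φ u₁ - φ u₂| ≤ |Θ| * dist u₁ u₂) → Continuous φ :=
    fun φ hφ => (LipschitzWith.of_dist_le_mul (K := ⟨|Θ|, abs_nonneg Θ⟩) hφ).continuous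
  have hcf : ∀ t, 0 ≤ t → ∀ i, Continuous (f t i) := fun t ht i => hcont _ (hlipf t ht i)
  obtain ⟨u₀⟩ : Nonempty U := inferInstance
  obtain ⟨D, hD⟩ : ∃ D, ∀ u : U, |Θ| * dist u u₀ ≤ D :=
    ⟨|Θ| * Metric.diam (univ : Set U), fun u => mul_le_mul_of_nonneg_left
      (Metric.dist_le_diam_of_mem isCompact_univ.isBounded (mem_univ u) (mem_univ u₀))
      (abs_nonneg Θ)⟩
  have hbd : ∀ t, 0 ≤ t → ∀ i u, |f t i u| ≤ (∑ j, |f t j u₀|) + D := by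
    intro t ht i u
    have h1 := hlipf t ht i u u₀
    have h2 : |f t i u₀| ≤ ∑ j, |f t j u₀| :=
      Finset.single_le_sum (f := fun j => |f t j u₀|) (fun j _ => abs_nonneg _) (Finset.mem_univ i)
    have h3 := abs_sub_abs_le_abs_sub (f t i u) (f t i u₀)
    linarith [hD u]
  have hfin : ∀ t, 0 ≤ t → (⨆ i, ⨆ u, ‖f t i u‖ₑ) ≠ ∞ := by
    intro t ht
    refine ne_top_of_le_ne_top (ENNReal.ofReal_ne_top (r := (∑ j, |f t j u₀|) + D))
      (iSup_le fun i => iSup_le fun u => ?_)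
    rw [← ofReal_norm]
    exact ENNReal.ofReal_le_ofReal (hbd t ht i u)
  -- Continuity in `u` reduces the uncountable supremum to one over a dense sequence.
  have hmeas : AEMeasurable (fun t => ⨆ i, ⨆ u, ‖f t i u‖ₑ) (volume.restrict (Ici (0 : ℝ))) := by
    have h1 : AEMeasurable (fun t => ⨆ i, ⨆ n, ‖f t i (TopologicalSpace.denseSeq U n)‖ₑ)
        (volume.restrict (Ici (0 : ℝ))) :=
      AEMeasurable.iSup fun i => AEMeasurable.iSup fun n =>
        ((hf_cont i _).aestronglyMeasurable measurableSet_Ici).enorm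
    refine h1.congr ((ae_restrict_mem measurableSet_Ici).mono fun t ht => ?_)
    refine iSup_congr fun i => le_antisymm (iSup_le fun n => le_iSup (fun u => ‖f t i u‖ₑ) _)
      (iSup_le fun u => ?_)
    exact (TopologicalSpace.denseRange_denseSeq U).induction_on
      (p := fun u => ‖f t i u‖ₑ ≤ ⨆ n, ‖f t i (TopologicalSpace.denseSeq U n)‖ₑ) u
      (isClosed_le (hcf t ht i).enorm continuous_const)
      fun n => le_iSup (fun n => ‖f t i (TopologicalSpace.denseSeq U n)‖ₑ) n
  refine ⟨hq, fun i j => hcont _ (hlipq i j), hcf, hf_cont, ?_, fun t ht i u => ?_, fun T => ?_⟩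
  · exact (integrable_toReal_of_lintegral_ne_top hmeas hf_int.ne).mono_measure
      (Measure.restrict_mono Ioi_subset_Ici_self le_rfl)
  · rw [← Real.norm_eq_abs, ← toReal_enorm]
    exact ENNReal.toReal_mono (hfin t ht) (le_iSup₂ (f := fun i u => ‖f t i u‖ₑ) i u)
  · have hc : ContinuousOn (fun t => ∑ j, |f t j u₀|) (Icc 0 T) :=
      continuousOn_finsetSum _ fun j _ => ((hf_cont j u₀).mono Icc_subset_Ici_self).abs
    obtain ⟨C, hC⟩ := isCompact_Icc.exists_bound_of_continuousOn hc
    exact ⟨C + D, fun t ht i u => (hbd t ht.1 i u).trans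
      (add_le_add_left ((le_abs_self _).trans (hC t ht)) D)⟩

end Lipschitz

end RelaxedMDP

theorem mainTheorem4 {d ℓ : ℕ} (U : Set (EuclideanSpace ℝ (Fin ℓ)))
    (hU : IsCompact U) (hU_pos : 0 < volume U)
    (q : U → Matrix (Fin d) (Fin d) ℝ) (hq : ∀ u, RelaxedMDP.IsRateMatrix (q u))
    (f : ℝ → Fin d → U → ℝ)
    (hf_cont : ∀ i u, ContinuousOn (fun t => f t i u) (Set.Ici 0))
    (hf_int : ∫⁻ t in Set.Ici (0 : ℝ), ⨆ i, ⨆ u, ‖f t i u‖ₑ < ∞)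
    (h_lip : ∃ Θ : ℝ, ∀ t : ℝ, 0 ≤ t → ∀ (i : Fin d) (u₁ u₂ : U),
      |f t i u₁ - f t i u₂| + ‖WithLp.toLp 2 (q u₁ i - q u₂ i)‖
        ≤ Θ * ‖(u₁ : EuclideanSpace ℝ (Fin ℓ)) - u₂‖)
    (h_cone : RelaxedMDP.UniformConeCondition U) :
    ∃ π : RelaxedMDP.RelaxedControl d U, RelaxedMDP.IsRelaxedEquilibrium q f π := by
  have : CompactSpace U := isCompact_iff_compactSpace.1 hU
  have hne : U.Nonempty := nonempty_of_measure_ne_zero hU_pos.ne'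
  have : Nonempty U := hne.to_subtype
  obtain ⟨Θ, h_lip⟩ := h_lip
  exact (RelaxedMDP.isRegular_of_lipschitz hU hne hq hf_cont hf_int h_lip).exists_isRelaxedEquilibrium
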